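/- Let $G=(VG,EG,o,t)$ be a directed graph (loops, multiple edges and sinks allowed) in which every vertex is the origin of only finitely many edges, and let $R\in VG$ be a root, i.e. every vertex is reached by a walk from $R$. For a walk $p$ write $T(p)$ for its terminal vertex. Let $\mathcal T=\mathcal T(G,R)$ be the unfolding tree, whose vertices are the walks originating in $R$ (including the empty walk), ordered by the prefix order: $p\le q$ iff $q=pr$ for some walk $r$. A *cofinite subspace* is a set $\mathcal S\subseteq\mathcal T$ with finite complement such that $p\in\mathcal S$, $p\le q$ imply $q\in\mathcal S$, and which is inescapable: every $p\in\mathcal T$ is a prefix of an element of $\mathcal S$. Its basis is the set of its minimal elements. A *basis* of $\mathcal T$ is an inclusion-maximal finite set of walks none of which is a prefix of another. An almost automorphism of $\mathcal T$ is an equivalence class of isomorphisms (of ordered sets) $\phi:\mathcal S\to\mathcal S'$ between cofinite subspaces, where two such maps are equivalent if they agree on some cofinite subspace; almost automorphisms form a group under composition of (suitably restricted) representatives. The Higman–Thompson group $\mathcal{HT}(\mathcal T(G,R))$ is the subgroup of the classes that have a representative $\phi:\mathcal S\to\mathcal S'$ such that, for every $b$ in the basis of $\mathcal S$, $T(\phi(b))=T(b)$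 and $\phi(bp)=\phi(b)p$ for all walks $p$ originating in $T(b)$. Let $L_{\mathbb Z}(G)$ be the Leavitt path algebra: the (a priori non-unital) associative $\mathbb Z$-algebra generated by $VG\sqcup\{e,e^*\mid e\in EG\}$ with the relations $vw=\delta_{v,w}v$; $e^*e'=\delta_{e,e'}t(e)$; $o(e)e=e\,t(e)=e$; $t(e)e^*=e^*o(e)=e^*$; and $v=\sum_{e\in o^{-1}(v)}ee^*$ for every vertex $v$ that is not a sink. It carries the involution $*$ that is additive, reverses products, fixes the vertices and exchanges $e$ and $e^*$. A walk is identified with the product of its edges (the empty walk at $v$ with $v$). Let $L_{\mathbb Z}(G,R)$ be the $\mathbb Z$-span of all $pq^*$ with $p,q$ walks originating in $R$ and $T(p)=T(q)$; it is a $*$-subalgebra of $L_{\mathbb Z}(G)$ with unit $R$. Put $$U(L_{\mathbb Z}(G,R))=\{x\in L_{\mathbb Z}(G,R)\mid xx^*=x^*x=R\},\qquad DU(L_{\mathbb Z}(G,R))=\Big\{\sum_{b\in B}\kappa_b\,bb^*\;\Big|\;B\text{ a basis of }\mathcal T(G,R),\ \kappa_b\in\{1,-1\}\Big\}.$$ **Lemma.**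 $DU(L_{\mathbb Z}(G,R))$ is a normal subgroup of $U(L_{\mathbb Z}(G,R))$, and there is a group isomorphism $$\mathcal{HT}(\mathcal T(G,R))\cong U(L_{\mathbb Z}(G,R))/DU(L_{\mathbb Z}(G,R)).$$ -/

import Mathlib

/-! ### Directed multigraphs, walks and unfolding trees -/

/-- A directed graph (loops and multiple edges allowed) with vertex set `V`, edge set `E`,
origin map `o` and terminus map `t`. -/
structure DirGraph (V E : Type*) where
  /-- the origin of an edge -/
  o : E → V
  /-- the terminus of an edge -/
  t : E → V

namespace DirGraph

variable {V E : Type*}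

/-- `G.IsWalk v l`: the list of edges `l` is a walk originating in `v`
(the empty list is the empty walk based at `v`). -/
def IsWalk (G : DirGraph V E) : V → List E → Prop
  | _, [] => True
  | v, e :: l => G.o e = v ∧ G.IsWalk (G.t e) l

/-- The terminal vertex of the walk `l` originating in `v`. -/
def terminus (G : DirGraph V E) : V → List E → V
  | v, [] => v
  | _, e :: l => G.terminus (G.t e) l

/-- `R` is a root: every vertex (hence also every edge) is reached by a walk from `R`. -/
def IsRoot (G : DirGraph V E) (R : V) : Prop :=
  ∀ v, ∃ l, G.IsWalk R l ∧ G.terminus R l = v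

/-- Every vertex is the origin of only finitely many edges. -/
def RowFinite (G : DirGraph V E) : Prop :=
  ∀ v, {e | G.o e = v}.Finite

theorem isWalk_append (G : DirGraph V E) {v : V} {l m : List E} :
    G.IsWalk v (l ++ m) ↔ G.IsWalk v l ∧ G.IsWalk (G.terminus v l) m := by
  induction l generalizing v with
  | nil => simp [IsWalk, terminus]
  | cons e l ih => simp [IsWalk, terminus, ih, and_assoc]

theorem terminus_append (G : DirGraph V E) {v : V} {l m : List E} :
    G.terminus v (l ++ m) = G.terminus (G.terminus v l) m := by
  induction l generalizing v with
  | nil => rfl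
  | cons e l ih => simp [terminus, ih]

/-- The walks of `G` originating in `R`: these are the vertices of the unfolding
tree of `G` based at `R`. -/
@[ext]
structure WalksFrom (G : DirGraph V E) (R : V) where
  /-- the sequence of edges of the walk -/
  edges : List E
  isWalk : G.IsWalk R edges

namespace WalksFrom

variable {G : DirGraph V E} {R : V}

/-- The terminal vertex `T(p)`. -/
def T (p : WalksFrom G R) : V := G.terminus R p.edges

/-- The concatenation `pr` of `p` with a walk `r` originating in `T(p)`. -/
def append (p : WalksFrom G R) (r : WalksFrom G p.T) : WalksFrom G R :=
  ⟨p.edges ++ r.edges, G.isWalk_append.2 ⟨p.isWalk, r.isWalk⟩⟩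

/-- The prefix order: `p ≤ q` iff `q = pr` for some walk `r`. -/
instance : PartialOrder (WalksFrom G R) where
  le p q := p.edges <+: q.edges
  le_refl p := List.prefix_refl p.edges
  le_trans _ _ _ h h' := List.IsPrefix.trans h h'
  le_antisymm _ _ h h' := WalksFrom.ext (h.eq_of_length_le h'.length_le)

theorem le_iff_exists_append {p q : WalksFrom G R} : p ≤ q ↔ ∃ r, q = p.append r := by
  constructor
  · rintro ⟨l, hl⟩
    have h := q.isWalk
    rw [← hl, G.isWalk_append] at h
    exact ⟨⟨l, h.2⟩, WalksFrom.ext hl.symm⟩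
  · rintro ⟨r, rfl⟩
    exact ⟨r.edges, rfl⟩

end WalksFrom

end DirGraph

/-! ### Cofinite subspaces, bases and almost automorphisms of a tree, given by its vertex set `α`
with the prefix order -/

/-- A cofinite (inescapable) subspace: a subset with finite complement which is closed under passing
to larger elements, and such that every element lies below an element of it. The last condition says
that the set of its minimal elements is a *maximal* set of pairwise incomparable elements; it is
automatic if every element has infinitely many elements above it. -/
structure IsCofiniteSubspace {α : Type*} [PartialOrder α] (S : Set α) : Prop where
  finite_compl : Sᶜ.Finite
  upper : ∀ ⦃p⦄, p ∈ S → ∀ ⦃q⦄, p ≤ q → q ∈ S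
  inescapable : ∀ p, ∃ q ∈ S, p ≤ q

/-- The basis of a subspace `S`: its minimal elements, which form the unique independent subset `B`
such that every element of `S` has a prefix in `B`. -/
def basisOf {α : Type*} [PartialOrder α] (S : Set α) : Set α := {b | Minimal (· ∈ S) b}

/-- A basis: an inclusion-maximal finite independent set, where independent means that
no element is a prefix of another one. -/
def IsTreeBasis {α : Type*} [PartialOrder α] (B : Finset α) : Prop :=
  Maximal (fun C : Finset α => IsAntichain (· ≤ ·) (C : Set α)) B

/-- A representative of an almost automorphism: an isomorphism between two cofinite subspaces
(`source` and `target`). The values of the underlying functions outside `source` and `target`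
are irrelevant. -/
structure AlmostAutRep (α : Type*) [PartialOrder α] extends PartialEquiv α α where
  source_cofinite : IsCofiniteSubspace source
  target_cofinite : IsCofiniteSubspace target
  map_le_map_iff : ∀ x ∈ source, ∀ y ∈ source, toFun x ≤ toFun y ↔ x ≤ y

namespace IsCofiniteSubspace

variable {α : Type*} [PartialOrder α]

theorem univ : IsCofiniteSubspace (Set.univ : Set α) :=
  ⟨by simp, fun _ _ _ _ => trivial, fun p => ⟨p, trivial, le_rfl⟩⟩

theorem inter {S S' : Set α} (h : IsCofiniteSubspace S) (h' : IsCofiniteSubspace S') :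
    IsCofiniteSubspace (S ∩ S') := by
  refine ⟨?_, fun p hp q hq => ⟨h.upper hp.1 hq, h'.upper hp.2 hq⟩, fun p => ?_⟩
  · rw [Set.compl_inter]
    exact h.finite_compl.union h'.finite_compl
  · obtain ⟨q, hq, hpq⟩ := h.inescapable p
    obtain ⟨r, hr, hqr⟩ := h'.inescapable q
    exact ⟨r, ⟨h.upper hq hqr, hr⟩, hpq.trans hqr⟩

end IsCofiniteSubspace

namespace AlmostAutRep

variable {α : Type*} [PartialOrder α]

/-- The identity of the whole tree. -/
protected def refl : AlmostAutRep α where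
  toPartialEquiv := PartialEquiv.refl α
  source_cofinite := IsCofiniteSubspace.univ
  target_cofinite := IsCofiniteSubspace.univ
  map_le_map_iff _ _ _ _ := Iff.rfl

/-- The inverse isomorphism. -/
protected def symm (φ : AlmostAutRep α) : AlmostAutRep α where
  toPartialEquiv := φ.toPartialEquiv.symm
  source_cofinite := φ.target_cofinite
  target_cofinite := φ.source_cofinite
  map_le_map_iff x hx y hy := by
    have h := φ.map_le_map_iff _ (φ.toPartialEquiv.map_target hx) _
      (φ.toPartialEquiv.map_target hy)
    rw [φ.toPartialEquiv.right_inv hx, φ.toPartialEquiv.right_inv hy] at h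
    exact h.symm

theorem preimage_cofinite (φ : AlmostAutRep α) {S : Set α} (hS : IsCofiniteSubspace S) :
    IsCofiniteSubspace (φ.source ∩ φ.toPartialEquiv ⁻¹' S) := by
  refine ⟨?_, ?_, ?_⟩
  · refine (φ.source_cofinite.finite_compl.union
      (hS.finite_compl.image φ.toPartialEquiv.symm)).subset ?_
    intro x hx
    by_cases hxs : x ∈ φ.source
    · exact Or.inr ⟨φ.toPartialEquiv x, fun h => hx ⟨hxs, h⟩, φ.toPartialEquiv.left_inv hxs⟩
    · exact Or.inl hxs
  · rintro p ⟨hp, hp'⟩ q hq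
    have hqs := φ.source_cofinite.upper hp hq
    exact ⟨hqs, hS.upper hp' ((φ.map_le_map_iff p hp q hqs).2 hq)⟩
  · intro p
    obtain ⟨q, hq, hpq⟩ := φ.source_cofinite.inescapable p
    obtain ⟨r, hr, hqr⟩ := hS.inescapable (φ.toPartialEquiv q)
    have hrt := φ.target_cofinite.upper (φ.toPartialEquiv.map_source hq) hqr
    refine ⟨φ.toPartialEquiv.symm r, ⟨φ.toPartialEquiv.map_target hrt, ?_⟩, hpq.trans ?_⟩
    · simpa [φ.toPartialEquiv.right_inv hrt] using hr
    · refine (φ.map_le_map_iff q hq _ (φ.toPartialEquiv.map_target hrt)).1 ?_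
      exact hqr.trans (φ.toPartialEquiv.right_inv hrt).ge

/-- The composition `φ ∘ ψ`, defined where it makes sense. -/
protected def comp (φ ψ : AlmostAutRep α) : AlmostAutRep α where
  toPartialEquiv := ψ.toPartialEquiv.trans φ.toPartialEquiv
  source_cofinite := by
    rw [PartialEquiv.trans_source]
    exact ψ.preimage_cofinite φ.source_cofinite
  target_cofinite := by
    rw [PartialEquiv.trans_target]
    exact φ.symm.preimage_cofinite ψ.target_cofinite
  map_le_map_iff x hx y hy := by
    rw [PartialEquiv.trans_source] at hx hy
    exact (φ.map_le_map_iff _ hx.2 _ hy.2).trans (ψ.map_le_map_iff _ hx.1 _ hy.1)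

/-- Two representatives are equivalent if they agree on some cofinite subspace. -/
def Equivalent (φ ψ : AlmostAutRep α) : Prop :=
  ∃ S, IsCofiniteSubspace S ∧ S ⊆ φ.source ∧ S ⊆ ψ.source ∧
    Set.EqOn φ.toPartialEquiv ψ.toPartialEquiv S

/-- Equivalence of representatives. -/
instance setoid (α : Type*) [PartialOrder α] : Setoid (AlmostAutRep α) where
  r := Equivalent
  iseqv :=
    { refl := fun φ => ⟨_, φ.source_cofinite, subset_rfl, subset_rfl, fun _ _ => rfl⟩
      symm := fun ⟨S, hS, h, h', e⟩ => ⟨S, hS, h', h, e.symm⟩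
      trans := fun ⟨S, hS, h, _, e⟩ ⟨S', hS', _, k', e'⟩ =>
        ⟨S ∩ S', hS.inter hS', fun _ hx => h hx.1, fun _ hx => k' hx.2,
          fun _ hx => (e hx.1).trans (e' hx.2)⟩ }

theorem comp_equivalent {φ φ' ψ ψ' : AlmostAutRep α} (h : φ ≈ φ') (h' : ψ ≈ ψ') :
    φ.comp ψ ≈ φ'.comp ψ' := by
  obtain ⟨S, hS, h1, h2, e⟩ := h
  obtain ⟨S', hS', h1', h2', e'⟩ := h'
  refine ⟨S' ∩ (ψ.source ∩ ψ.toPartialEquiv ⁻¹' S), hS'.inter (ψ.preimage_cofinite hS), ?_, ?_, ?_⟩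
  · rintro x ⟨hx, hx', hx''⟩
    exact (PartialEquiv.trans_source _ _).ge ⟨hx', h1 hx''⟩
  · rintro x ⟨hx, hx', hx''⟩
    refine (PartialEquiv.trans_source _ _).ge ⟨h2' hx, ?_⟩
    have hx3 : ψ.toPartialEquiv x ∈ S := hx''
    rw [e' hx] at hx3
    exact h2 hx3
  · rintro x ⟨hx, hx', hx''⟩
    have hx3 : ψ.toPartialEquiv x ∈ S := hx''
    change φ.toPartialEquiv (ψ.toPartialEquiv x) = φ'.toPartialEquiv (ψ'.toPartialEquiv x)
    rw [← e' hx]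
    exact e hx3

theorem symm_equivalent {φ φ' : AlmostAutRep α} (h : φ ≈ φ') : φ.symm ≈ φ'.symm := by
  obtain ⟨S, hS, h1, h2, e⟩ := h
  refine ⟨_, (φ.symm.preimage_cofinite hS), fun _ hx => hx.1, ?_, ?_⟩
  · rintro x ⟨hx, hx'⟩
    have hx3 : φ.toPartialEquiv.symm x ∈ S := hx'
    have := φ'.toPartialEquiv.map_source (h2 hx3)
    rw [← e hx3, φ.toPartialEquiv.right_inv hx] at this
    exact this
  · rintro x ⟨hx, hx'⟩
    have hx3 : φ.toPartialEquiv.symm x ∈ S := hx'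
    have := φ'.toPartialEquiv.left_inv (h2 hx3)
    rw [← e hx3, φ.toPartialEquiv.right_inv hx] at this
    exact this.symm

end AlmostAutRep

/-- The group of almost automorphisms: equivalence classes of representatives. -/
def AlmostAut (α : Type*) [PartialOrder α] : Type _ := Quotient (AlmostAutRep.setoid α)

namespace AlmostAut

variable {α : Type*} [PartialOrder α]

/-- The class of a representative. -/
def mk (φ : AlmostAutRep α) : AlmostAut α := Quotient.mk _ φ

/-- The multiplication is the composition of representatives. -/
instance : Group (AlmostAut α) where
  mul := Quotient.map₂ AlmostAutRep.comp fun _ _ h _ _ h' => AlmostAutRep.comp_equivalent h h'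
  one := mk AlmostAutRep.refl
  inv := Quotient.map AlmostAutRep.symm fun _ _ h => AlmostAutRep.symm_equivalent h
  mul_assoc := by
    rintro ⟨a⟩ ⟨b⟩ ⟨c⟩
    refine Quotient.sound ⟨_, ((a.comp b).comp c).source_cofinite, subset_rfl, ?_, fun _ _ => rfl⟩
    exact (congrArg PartialEquiv.source (PartialEquiv.trans_assoc c.toPartialEquiv
      b.toPartialEquiv a.toPartialEquiv)).ge
  one_mul := by
    rintro ⟨a⟩
    refine Quotient.sound ⟨_, a.source_cofinite, ?_, subset_rfl, fun _ _ => rfl⟩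
    exact (congrArg PartialEquiv.source (PartialEquiv.trans_refl a.toPartialEquiv)).ge
  mul_one := by
    rintro ⟨a⟩
    refine Quotient.sound ⟨_, a.source_cofinite, ?_, subset_rfl, fun _ _ => rfl⟩
    exact (congrArg PartialEquiv.source (PartialEquiv.refl_trans a.toPartialEquiv)).ge
  inv_mul_cancel := by
    rintro ⟨a⟩
    refine Quotient.sound ⟨_, a.source_cofinite, ?_, fun _ _ => trivial, ?_⟩
    · intro x hx
      exact (PartialEquiv.trans_source _ _).ge ⟨hx, a.toPartialEquiv.map_source hx⟩
    · intro x hx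
      exact a.toPartialEquiv.left_inv hx

theorem mk_mul_mk (φ ψ : AlmostAutRep α) : mk φ * mk ψ = mk (φ.comp ψ) := rfl

theorem inv_mk (φ : AlmostAutRep α) : (mk φ)⁻¹ = mk φ.symm := rfl

end AlmostAut

/-! ### The Higman-Thompson group of an unfolding tree -/

namespace DirGraph

variable {V E : Type*}

/-- Higman-Thompson representatives: if `B` is the basis of the domain of `φ`, then
`φ (b p) = φ (b) p` for all `b ∈ B` and all walks `p` originating in `T(b)`. (For `φ (b) p` to make
sense, `φ (b)` has to end in `T(b)`; this is part of the condition.) -/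
def IsHTRep {G : DirGraph V E} {R : V} (φ : AlmostAutRep (WalksFrom G R)) : Prop :=
  ∀ b ∈ basisOf φ.source, (φ.toPartialEquiv b).T = b.T ∧
    ∀ p : WalksFrom G b.T,
      (φ.toPartialEquiv (b.append p)).edges = (φ.toPartialEquiv b).edges ++ p.edges

theorem exists_basisOf_le {G : DirGraph V E} {R : V} {S : Set (WalksFrom G R)} {x : WalksFrom G R}
    (hx : x ∈ S) : ∃ b ∈ basisOf S, b ≤ x := by
  induction hn : x.edges.length using Nat.strong_induction_on generalizing x with
  | _ n ih =>
    by_cases hmin : Minimal (· ∈ S) x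
    · exact ⟨x, hmin, le_rfl⟩
    · obtain ⟨y, hy, hyS⟩ := (not_minimal_iff_exists_lt (P := (· ∈ S)) hx).1 hmin
      have hlen : y.edges.length < x.edges.length := by
        by_contra hlt
        exact hy.ne (WalksFrom.ext (List.IsPrefix.eq_of_length_le hy.le (not_lt.1 hlt)))
      obtain ⟨b, hb, hby⟩ := ih _ (hn ▸ hlen) hyS rfl
      exact ⟨b, hb, hby.trans hy.le⟩

/-- A Higman-Thompson representative satisfies its defining condition on its whole domain. -/
theorem isHTRep_iff {G : DirGraph V E} {R : V} (φ : AlmostAutRep (WalksFrom G R)) :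
    IsHTRep φ ↔ ∀ x ∈ φ.source, (φ.toPartialEquiv x).T = x.T ∧
      ∀ p : WalksFrom G x.T,
        (φ.toPartialEquiv (x.append p)).edges = (φ.toPartialEquiv x).edges ++ p.edges := by
  constructor
  · intro h x hx
    obtain ⟨b, hb, hbx⟩ := exists_basisOf_le hx
    obtain ⟨r, rfl⟩ := WalksFrom.le_iff_exists_append.1 hbx
    obtain ⟨hT, hp⟩ := h b hb
    refine ⟨?_, fun p => ?_⟩
    · change G.terminus R (φ.toPartialEquiv (b.append r)).edges = G.terminus R (b.edges ++ r.edges)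
      rw [hp r, terminus_append, terminus_append]
      exact congrArg (fun v => G.terminus v r.edges) hT
    · have hw : G.IsWalk b.T (r.edges ++ p.edges) := by
        refine G.isWalk_append.2 ⟨r.isWalk, ?_⟩
        have := p.isWalk
        simpa [WalksFrom.T, WalksFrom.append, terminus_append] using this
      have key := hp ⟨_, hw⟩
      have e : b.append ⟨r.edges ++ p.edges, hw⟩ = (b.append r).append p :=
        WalksFrom.ext (by simp [WalksFrom.append])
      rw [e] at key
      rw [key, hp r, List.append_assoc]
  · exact fun h b hb => h b hb.1

/-- The Higman-Thompson group of the unfolding tree of `G` based at `R`: the subgroup of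
all almost automorphisms that have a Higman-Thompson representative. -/
def HT (G : DirGraph V E) (R : V) : Subgroup (AlmostAut (WalksFrom G R)) where
  carrier := {g | ∃ φ, IsHTRep φ ∧ AlmostAut.mk φ = g}
  one_mem' := ⟨AlmostAutRep.refl, fun _ _ => ⟨rfl, fun _ => rfl⟩, rfl⟩
  mul_mem' := by
    rintro _ _ ⟨φ, hφ, rfl⟩ ⟨ψ, hψ, rfl⟩
    refine ⟨φ.comp ψ, ?_, rfl⟩
    rw [isHTRep_iff] at hφ hψ ⊢
    intro x hx
    have hx' : x ∈ ψ.source ∩ ψ.toPartialEquiv ⁻¹' φ.source :=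
      (PartialEquiv.trans_source _ _).le hx
    obtain ⟨h1, h2⟩ := hψ x hx'.1
    obtain ⟨h3, h4⟩ := hφ _ hx'.2
    refine ⟨h3.trans h1, fun p => ?_⟩
    have hw : G.IsWalk (ψ.toPartialEquiv x).T p.edges := by rw [h1]; exact p.isWalk
    have e : ψ.toPartialEquiv (x.append p) = (ψ.toPartialEquiv x).append ⟨p.edges, hw⟩ :=
      WalksFrom.ext (h2 p)
    change (φ.toPartialEquiv (ψ.toPartialEquiv (x.append p))).edges = _
    rw [e, h4]
    rfl
  inv_mem' := by
    rintro _ ⟨φ, hφ, rfl⟩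
    refine ⟨φ.symm, ?_, rfl⟩
    rw [isHTRep_iff] at hφ ⊢
    intro y hy
    have hy' : y ∈ φ.target := hy
    have hx := φ.toPartialEquiv.map_target hy'
    obtain ⟨h1, h2⟩ := hφ _ hx
    rw [φ.toPartialEquiv.right_inv hy'] at h1
    refine ⟨h1.symm, fun p => ?_⟩
    have hw : G.IsWalk (φ.toPartialEquiv.symm y).T p.edges := by rw [← h1]; exact p.isWalk
    have h3 := h2 ⟨p.edges, hw⟩
    rw [φ.toPartialEquiv.right_inv hy'] at h3
    have e : y.append p = φ.toPartialEquiv ((φ.toPartialEquiv.symm y).append ⟨p.edges, hw⟩) :=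
      WalksFrom.ext h3.symm
    have hs := φ.source_cofinite.upper hx
      (WalksFrom.le_iff_exists_append.2 ⟨⟨p.edges, hw⟩, rfl⟩)
    change (φ.toPartialEquiv.symm (y.append p)).edges = _
    rw [e, φ.toPartialEquiv.left_inv hs]
    rfl

/-! ### The Leavitt path algebra over `ℤ` -/

/-- The generators of the Leavitt path algebra: vertices `v`, edges `e` and
ghost edges `e*`. -/
inductive LPAGen (V E : Type*)
  | vertex (v : V)
  | edge (e : E)
  | ghost (e : E)

/-- The free (non-unital, associative) `ℤ`-algebra on vertices, edges and ghost edges. -/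
abbrev FreeLPA (V E : Type*) := MonoidAlgebra ℤ (FreeSemigroup (LPAGen V E))

/-- A generator, seen as an element of the free algebra. -/
noncomputable def genFree (x : LPAGen V E) : FreeLPA V E :=
  MonoidAlgebra.single (FreeSemigroup.of x) 1

open LPAGen in
/-- The defining relations of the Leavitt path algebra. The last one, `v = ∑ e e*` over the edges
with origin `v`, is imposed at the vertices with a finite and non-empty set of outgoing edges. -/
inductive LPARel (G : DirGraph V E) : FreeLPA V E → FreeLPA V E → Prop
  | vertex_mul_self (v : V) : LPARel G (genFree (vertex v) * genFree (vertex v)) (genFree (vertex v))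
  | vertex_mul_ne (v w : V) (h : v ≠ w) : LPARel G (genFree (vertex v) * genFree (vertex w)) 0
  | ghost_mul_self (e : E) : LPARel G (genFree (ghost e) * genFree (edge e)) (genFree (vertex (G.t e)))
  | ghost_mul_ne (e e' : E) (h : e ≠ e') : LPARel G (genFree (ghost e) * genFree (edge e')) 0
  | o_mul_edge (e : E) : LPARel G (genFree (vertex (G.o e)) * genFree (edge e)) (genFree (edge e))
  | edge_mul_t (e : E) : LPARel G (genFree (edge e) * genFree (vertex (G.t e))) (genFree (edge e))
  | t_mul_ghost (e : E) : LPARel G (genFree (vertex (G.t e)) * genFree (ghost e)) (genFree (ghost e))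
  | ghost_mul_o (e : E) : LPARel G (genFree (ghost e) * genFree (vertex (G.o e))) (genFree (ghost e))
  | sum_edge (v : V) (s : Finset E) (hs : s.Nonempty) (h : ∀ e, e ∈ s ↔ G.o e = v) :
      LPARel G (genFree (vertex v)) (∑ e ∈ s, genFree (edge e) * genFree (ghost e))

/-- The Leavitt path algebra `L_ℤ(G)`: the quotient of the free algebra by the congruence generated
by the defining relations. -/
def LPA (G : DirGraph V E) : Type _ := (ringConGen (LPARel G)).Quotient

namespace LPA

noncomputable instance (G : DirGraph V E) : NonUnitalRing (LPA G) :=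
  inferInstanceAs (NonUnitalRing (ringConGen (LPARel G)).Quotient)

/-- The class of an element of the free algebra. -/
noncomputable def mk (G : DirGraph V E) : FreeLPA V E →ₙ+* LPA G where
  toFun x := ((x : (ringConGen (LPARel G)).Quotient))
  map_zero' := rfl
  map_add' _ _ := rfl
  map_mul' _ _ := rfl

theorem mk_surjective (G : DirGraph V E) : Function.Surjective (mk G) := Quotient.mk''_surjective

theorem mk_eq_of_rel (G : DirGraph V E) {x y : FreeLPA V E} (h : LPARel G x y) :
    mk G x = mk G y :=
  Quotient.sound' (RingConGen.Rel.of _ _ h)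

/-- A generator, seen as an element of the Leavitt path algebra. -/
noncomputable def gen (G : DirGraph V E) (x : LPAGen V E) : LPA G := mk G (genFree x)

/-- The extension of a map on the generators to the free algebra. -/
noncomputable def freeLift {A : Type*} [NonUnitalRing A] (f : LPAGen V E → A) : FreeLPA V E →ₙ+* A :=
  ((MonoidAlgebra.liftMagma ℤ (FreeSemigroup.lift f) : FreeLPA V E →ₙₐ[ℤ] A) : FreeLPA V E →ₙ+* A)

@[simp]
theorem freeLift_genFree {A : Type*} [NonUnitalRing A] (f : LPAGen V E → A) (x : LPAGen V E) :
    freeLift f (genFree x) = f x := by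
  change MonoidAlgebra.liftMagma ℤ (FreeSemigroup.lift f) (MonoidAlgebra.single _ 1) = f x
  rw [MonoidAlgebra.liftMagma_apply_apply]
  simp

/-- The universal property of the Leavitt path algebra. -/
noncomputable def lift {G : DirGraph V E} {A : Type*} [NonUnitalRing A] (f : LPAGen V E → A)
    (hf : ∀ x y, LPARel G x y → freeLift f x = freeLift f y) : LPA G →ₙ+* A where
  toFun := Quotient.lift (s := (ringConGen (LPARel G)).toSetoid) (freeLift f) (by
    intro x y h
    have h' : RingConGen.Rel (LPARel G) x y := h
    clear h
    induction h' with
    | of x y h => exact hf x y h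
    | refl x => rfl
    | symm _ ih => exact ih.symm
    | trans _ _ ih ih' => exact ih.trans ih'
    | add _ _ ih ih' => rw [map_add, map_add, ih, ih']
    | mul _ _ ih ih' => rw [map_mul, map_mul, ih, ih'])
  map_zero' := map_zero (freeLift f)
  map_add' := by rintro ⟨x⟩ ⟨y⟩; exact map_add (freeLift f) x y
  map_mul' := by rintro ⟨x⟩ ⟨y⟩; exact map_mul (freeLift f) x y

theorem lift_mk {G : DirGraph V E} {A : Type*} [NonUnitalRing A] (f : LPAGen V E → A)
    (hf : ∀ x y, LPARel G x y → freeLift f x = freeLift f y) (x : FreeLPA V E) :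
    lift f hf (mk G x) = freeLift f x := rfl

theorem lift_gen {G : DirGraph V E} {A : Type*} [NonUnitalRing A] (f : LPAGen V E → A)
    (hf : ∀ x y, LPARel G x y → freeLift f x = freeLift f y) (x : LPAGen V E) :
    lift f hf (gen G x) = f x := by
  rw [gen, lift_mk, freeLift_genFree]

theorem hom_ext {G : DirGraph V E} {A : Type*} [NonUnitalRing A] {f g : LPA G →ₙ+* A}
    (h : ∀ x, f (gen G x) = g (gen G x)) : f = g := by
  ext y
  obtain ⟨y, rfl⟩ := mk_surjective G y
  induction y using MonoidAlgebra.induction_linear with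
  | zero => simp
  | add x y hx hy => simp [hx, hy]
  | single s n =>
    have e : (MonoidAlgebra.single s n : FreeLPA V E) = n • MonoidAlgebra.single s 1 := by simp
    rw [e, map_zsmul, map_zsmul, map_zsmul]
    congr 1
    induction s using FreeSemigroup.recOnMul with
    | ih1 x => exact h x
    | ih2 x y hx hy =>
      have e : (MonoidAlgebra.single (FreeSemigroup.of x * y) 1 : FreeLPA V E) =
          MonoidAlgebra.single (FreeSemigroup.of x) 1 * MonoidAlgebra.single y 1 := by
        simp [MonoidAlgebra.single_mul_single]
      simp only [e, map_mul]
      rw [hx (by simp), hy (by simp)]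

section relations

variable (G : DirGraph V E)

/-- The vertex `v` in the Leavitt path algebra. -/
noncomputable def vert (v : V) : LPA G := gen G (.vertex v)

/-- The edge `e` in the Leavitt path algebra. -/
noncomputable def edge (e : E) : LPA G := gen G (.edge e)

/-- The ghost edge `e*` in the Leavitt path algebra. -/
noncomputable def ghost (e : E) : LPA G := gen G (.ghost e)

theorem vert_mul_self (v : V) : vert G v * vert G v = vert G v :=
  mk_eq_of_rel G (.vertex_mul_self v)

theorem vert_mul_ne {v w : V} (h : v ≠ w) : vert G v * vert G w = 0 :=
  mk_eq_of_rel G (.vertex_mul_ne v w h)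

theorem ghost_mul_self (e : E) : ghost G e * edge G e = vert G (G.t e) :=
  mk_eq_of_rel G (.ghost_mul_self e)

theorem ghost_mul_ne {e e' : E} (h : e ≠ e') : ghost G e * edge G e' = 0 :=
  mk_eq_of_rel G (.ghost_mul_ne e e' h)

theorem o_mul_edge (e : E) : vert G (G.o e) * edge G e = edge G e :=
  mk_eq_of_rel G (.o_mul_edge e)

theorem edge_mul_t (e : E) : edge G e * vert G (G.t e) = edge G e :=
  mk_eq_of_rel G (.edge_mul_t e)

theorem t_mul_ghost (e : E) : vert G (G.t e) * ghost G e = ghost G e :=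
  mk_eq_of_rel G (.t_mul_ghost e)

theorem ghost_mul_o (e : E) : ghost G e * vert G (G.o e) = ghost G e :=
  mk_eq_of_rel G (.ghost_mul_o e)

theorem sum_edge (v : V) (s : Finset E) (hs : s.Nonempty) (h : ∀ e, e ∈ s ↔ G.o e = v) :
    vert G v = ∑ e ∈ s, edge G e * ghost G e := by
  have := mk_eq_of_rel G (.sum_edge v s hs h)
  rw [map_sum] at this
  simp only [map_mul] at this
  exact this

end relations

open MulOpposite in
/-- The values of the involution on the generators: `v ↦ v`, `e ↦ e*`, `e* ↦ e`. -/
noncomputable def starGen (G : DirGraph V E) : LPAGen V E → (LPA G)ᵐᵒᵖ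
  | .vertex v => op (vert G v)
  | .edge e => op (ghost G e)
  | .ghost e => op (edge G e)

open MulOpposite in
/-- The involution, as a homomorphism to the opposite ring. -/
noncomputable def starHom (G : DirGraph V E) : LPA G →ₙ+* (LPA G)ᵐᵒᵖ :=
  lift (starGen G) (by
    intro x y h
    induction h with
    | vertex_mul_self v => simp [starGen, ← op_mul, vert_mul_self]
    | vertex_mul_ne v w h => simp [starGen, ← op_mul, vert_mul_ne G h.symm]
    | ghost_mul_self e => simp [starGen, ← op_mul, ghost_mul_self]
    | ghost_mul_ne e e' h => simp [starGen, ← op_mul, ghost_mul_ne G h.symm]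
    | o_mul_edge e => simp [starGen, ← op_mul, ghost_mul_o]
    | edge_mul_t e => simp [starGen, ← op_mul, t_mul_ghost]
    | t_mul_ghost e => simp [starGen, ← op_mul, edge_mul_t]
    | ghost_mul_o e => simp [starGen, ← op_mul, o_mul_edge]
    | sum_edge v s hs h =>
      simp [starGen, ← op_mul, sum_edge G v s hs h])

theorem starHom_starHom (G : DirGraph V E) (x : LPA G) :
    (starHom G (starHom G x).unop).unop = x := by
  let f : LPA G →ₙ+* LPA G :=
    { toFun := fun x => (starHom G (starHom G x).unop).unop
      map_zero' := by simp
      map_add' := by simp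
      map_mul' := by simp }
  have h : f = NonUnitalRingHom.id (LPA G) := by
    apply hom_ext
    intro x
    change (starHom G (starHom G (gen G x)).unop).unop = gen G x
    rcases x with v | e | e <;>
      simp [starHom, lift_gen, starGen, vert, edge, ghost]
  exact congrArg (fun g : LPA G →ₙ+* LPA G => g x) h

/-- The involution `*` of the Leavitt path algebra: additive, reversing products, with `v* = v`
and exchanging `e` and `e*`. -/
noncomputable instance (G : DirGraph V E) : StarRing (LPA G) where
  star x := (starHom G x).unop
  star_involutive := starHom_starHom G
  star_mul x y := by simp
  star_add x y := by simp

theorem star_def {G : DirGraph V E} (x : LPA G) : star x = (starHom G x).unop := rfl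

theorem star_vert (G : DirGraph V E) (v : V) : star (vert G v) = vert G v := by
  simp [star_def, starHom, lift_gen, starGen, vert]

theorem star_edge (G : DirGraph V E) (e : E) : star (edge G e) = ghost G e := by
  simp [star_def, starHom, lift_gen, starGen, edge]

theorem star_ghost (G : DirGraph V E) (e : E) : star (ghost G e) = edge G e := by
  rw [← star_edge, star_star]

/-- The walk `l` originating in `v` as an element of the Leavitt path algebra: `v` for the empty
walk and the product of the edges otherwise (multiplied from the right by the terminal vertex,
which does not change the product). -/
noncomputable def word (G : DirGraph V E) : V → List E → LPA G
  | v, [] => vert G v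
  | _, e :: l => edge G e * word G (G.t e) l

theorem vert_mul_word {G : DirGraph V E} {v : V} {l : List E} (h : G.IsWalk v l) :
    vert G v * word G v l = word G v l := by
  cases l with
  | nil => exact vert_mul_self G v
  | cons e l =>
    obtain ⟨rfl, -⟩ := h
    simp only [word]
    rw [← mul_assoc, o_mul_edge]

theorem word_mul_vert (G : DirGraph V E) (v : V) (l : List E) :
    word G v l * vert G (G.terminus v l) = word G v l := by
  induction l generalizing v with
  | nil => exact vert_mul_self G v
  | cons e l ih => simp only [word, terminus, mul_assoc, ih]

theorem word_append {G : DirGraph V E} {v : V} {l m : List E}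
    (hm : G.IsWalk (G.terminus v l) m) :
    word G v (l ++ m) = word G v l * word G (G.terminus v l) m := by
  induction l generalizing v with
  | nil => exact (vert_mul_word hm).symm
  | cons e l ih => simp only [List.cons_append, word, terminus, mul_assoc]; rw [ih hm]

theorem star_word_mul_word {G : DirGraph V E} {v : V} {l m : List E} (hl : G.IsWalk v l)
    (hm : G.IsWalk v m) :
    star (word G v l) * word G v m = 0 ∨
    (∃ r, m = l ++ r ∧ G.IsWalk (G.terminus v l) r ∧
      star (word G v l) * word G v m = word G (G.terminus v l) r) ∨
    (∃ r, l = m ++ r ∧ G.IsWalk (G.terminus v m) r ∧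
      star (word G v l) * word G v m = star (word G (G.terminus v m) r)) := by
  induction l generalizing v m with
  | nil =>
    refine Or.inr (Or.inl ⟨m, rfl, hm, ?_⟩)
    simp only [word, star_vert, terminus]
    exact vert_mul_word hm
  | cons e l ih =>
    cases m with
    | nil =>
      refine Or.inr (Or.inr ⟨e :: l, rfl, hl, ?_⟩)
      conv_lhs => rw [word, ← star_vert, ← star_mul, vert_mul_word hl]
      rfl
    | cons f m =>
      by_cases h : e = f
      · subst h
        have key : star (word G v (e :: l)) * word G v (e :: m) =
            star (word G (G.t e) l) * word G (G.t e) m := by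
          simp only [word, star_mul, star_edge]
          rw [mul_assoc, ← mul_assoc (ghost G e), ghost_mul_self, vert_mul_word hm.2]
        rw [key]
        rcases ih hl.2 hm.2 with h | ⟨r, h1, h2, h3⟩ | ⟨r, h1, h2, h3⟩
        · exact Or.inl h
        · exact Or.inr (Or.inl ⟨r, by rw [h1]; rfl, h2, h3⟩)
        · exact Or.inr (Or.inr ⟨r, by rw [h1]; rfl, h2, h3⟩)
      · left
        simp only [word, star_mul, star_edge]
        rw [mul_assoc, ← mul_assoc (ghost G e), ghost_mul_ne G h, zero_mul, mul_zero]

end LPA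

/-- A walk as an element of the Leavitt path algebra. -/
noncomputable def WalksFrom.elt {G : DirGraph V E} {R : V} (p : WalksFrom G R) : LPA G :=
  LPA.word G R p.edges

/-! ### The rooted Leavitt path algebra over `ℤ` and its unitary group -/

/-- The `ℤ`-submodule of `L_ℤ(G)` spanned by the elements `p q*` for walks `p`, `q` that originate
in `R` and have the same terminal vertex. -/
noncomputable def rootedSpan (G : DirGraph V E) (R : V) : Submodule ℤ (LPA G) :=
  Submodule.span ℤ {x | ∃ p q : WalksFrom G R, p.T = q.T ∧ x = p.elt * star q.elt}

section rooted

variable {G : DirGraph V E} {R : V}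

theorem elt_mul_star_mem (p q : WalksFrom G R) (h : p.T = q.T) :
    p.elt * star q.elt ∈ rootedSpan G R :=
  Submodule.subset_span ⟨p, q, h, rfl⟩

theorem elt_append (p : WalksFrom G R) (r : WalksFrom G p.T) :
    (p.append r).elt = p.elt * r.elt :=
  LPA.word_append r.isWalk

theorem append_T (p : WalksFrom G R) (r : WalksFrom G p.T) : (p.append r).T = r.T :=
  G.terminus_append

theorem rootedSpan_mul_mem {x y : LPA G} (hx : x ∈ rootedSpan G R) (hy : y ∈ rootedSpan G R) :
    x * y ∈ rootedSpan G R := by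
  induction hx using Submodule.span_induction with
  | zero => rw [zero_mul]; exact zero_mem _
  | add x x' _ _ h h' => rw [add_mul]; exact add_mem h h'
  | smul a x _ h => rw [smul_mul_assoc]; exact Submodule.smul_mem _ a h
  | mem x hx =>
    obtain ⟨p, q, hpq, rfl⟩ := hx
    induction hy using Submodule.span_induction with
    | zero => rw [mul_zero]; exact zero_mem _
    | add x x' _ _ h h' => rw [mul_add]; exact add_mem h h'
    | smul a x _ h => rw [mul_smul_comm]; exact Submodule.smul_mem _ a h
    | mem y hy =>
      obtain ⟨r, s, hrs, rfl⟩ := hy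
      have e : p.elt * star q.elt * (r.elt * star s.elt) =
          p.elt * (star q.elt * r.elt) * star s.elt := by simp only [mul_assoc]
      rw [e]
      rcases LPA.star_word_mul_word q.isWalk r.isWalk with h | ⟨m, h1, h2, h3⟩ | ⟨m, h1, h2, h3⟩
      · change star q.elt * r.elt = 0 at h
        rw [h, mul_zero, zero_mul]
        exact zero_mem _
      · change star q.elt * r.elt = LPA.word G q.T m at h3
        change G.IsWalk q.T m at h2
        rw [← hpq] at h2 h3
        rw [h3, show p.elt * LPA.word G p.T m = (p.append ⟨m, h2⟩).elt from
          (elt_append p ⟨m, h2⟩).symm]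
        refine elt_mul_star_mem _ _ ?_
        rw [append_T, ← hrs]
        change G.terminus p.T m = G.terminus R r.edges
        rw [h1, terminus_append, hpq]
        rfl
      · change star q.elt * r.elt = star (LPA.word G r.T m) at h3
        change G.IsWalk r.T m at h2
        rw [hrs] at h2 h3
        rw [h3, mul_assoc, ← star_mul, show s.elt * LPA.word G s.T m = (s.append ⟨m, h2⟩).elt from
          (elt_append s ⟨m, h2⟩).symm]
        refine elt_mul_star_mem _ _ ?_
        rw [append_T, hpq]
        change G.terminus R q.edges = G.terminus s.T m
        rw [h1, terminus_append, ← hrs]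
        rfl

theorem rootedSpan_star_mem {x : LPA G} (hx : x ∈ rootedSpan G R) : star x ∈ rootedSpan G R := by
  induction hx using Submodule.span_induction with
  | zero => rw [star_zero]; exact zero_mem _
  | add x x' _ _ h h' => rw [star_add]; exact add_mem h h'
  | smul a x _ h =>
    have e : star (a • x) = a • star x := map_zsmul (starAddEquiv : LPA G ≃+ LPA G) a x
    rw [e]
    exact Submodule.smul_mem _ a h
  | mem x hx =>
    obtain ⟨p, q, hpq, rfl⟩ := hx
    rw [star_mul, star_star]
    exact elt_mul_star_mem q p hpq.symm

theorem vert_mem_rootedSpan : LPA.vert G R ∈ rootedSpan G R := by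
  have h := elt_mul_star_mem (G := G) (R := R) ⟨[], trivial⟩ ⟨[], trivial⟩ rfl
  simpa [WalksFrom.elt, LPA.word, LPA.star_vert, LPA.vert_mul_self] using h

theorem vert_mul_of_mem {x : LPA G} (hx : x ∈ rootedSpan G R) : LPA.vert G R * x = x := by
  induction hx using Submodule.span_induction with
  | zero => rw [mul_zero]
  | add x x' _ _ h h' => rw [mul_add, h, h']
  | smul a x _ h => rw [mul_smul_comm, h]
  | mem x hx =>
    obtain ⟨p, q, hpq, rfl⟩ := hx
    rw [← mul_assoc]
    congr 1
    exact LPA.vert_mul_word p.isWalk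

theorem mul_vert_of_mem {x : LPA G} (hx : x ∈ rootedSpan G R) : x * LPA.vert G R = x := by
  have h := vert_mul_of_mem (rootedSpan_star_mem hx)
  rw [← star_inj, star_mul, LPA.star_vert, h]

end rooted

/-- The rooted Leavitt path algebra as a non-unital subring of `L_ℤ(G)`. -/
noncomputable def rootedSubring (G : DirGraph V E) (R : V) : NonUnitalSubring (LPA G) where
  carrier := rootedSpan G R
  zero_mem' := zero_mem _
  add_mem' := add_mem
  neg_mem' := neg_mem
  mul_mem' := rootedSpan_mul_mem

/-- The rooted Leavitt path algebra `L_ℤ(G, R)`. -/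
def RootedLPA (G : DirGraph V E) (R : V) : Type _ := rootedSubring G R

namespace RootedLPA

variable {G : DirGraph V E} {R : V}

/-- The inclusion into `L_ℤ(G)`. -/
def val (x : RootedLPA G R) : LPA G := Subtype.val x

/-- `L_ℤ(G, R)` with the operations of `L_ℤ(G)`; the unit is the vertex `R`. -/
noncomputable instance : Ring (RootedLPA G R) where
  __ := (inferInstance : NonUnitalRing (rootedSubring G R))
  one := ⟨LPA.vert G R, vert_mem_rootedSpan⟩
  one_mul x := Subtype.ext (vert_mul_of_mem x.2)
  mul_one x := Subtype.ext (mul_vert_of_mem x.2)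

/-- The involution of `L_ℤ(G, R)` is the restriction of the one of `L_ℤ(G)`. -/
noncomputable instance : StarRing (RootedLPA G R) where
  star x := ⟨star x.1, rootedSpan_star_mem x.2⟩
  star_involutive x := Subtype.ext (star_star x.1)
  star_mul x y := Subtype.ext (star_mul x.1 y.1)
  star_add x y := Subtype.ext (star_add x.1 y.1)

theorem val_injective : Function.Injective (val : RootedLPA G R → LPA G) := Subtype.val_injective

theorem val_one : (1 : RootedLPA G R).val = LPA.vert G R := rfl

theorem val_mul (x y : RootedLPA G R) : (x * y).val = x.val * y.val := rfl

theorem val_add (x y : RootedLPA G R) : (x + y).val = x.val + y.val := rfl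

theorem val_star (x : RootedLPA G R) : (star x).val = star x.val := rfl

end RootedLPA

/-- The diagonal unitary elements `∑_{b ∈ B} κ_b b b*` of `L_ℤ(G, R)`, for bases `B` of the unfolding
tree and signs `κ_b = ±1`. -/
def DU (G : DirGraph V E) (R : V) : Set (RootedLPA G R) :=
  {x | ∃ (B : Finset (WalksFrom G R)) (κ : WalksFrom G R → ℤˣ), IsTreeBasis B ∧
    x.val = ∑ b ∈ B, (κ b : ℤ) • (b.elt * star b.elt)}

end DirGraph

/-!
A unitary element `u` of `L_ℤ(G, R)` permutes, up to signs, almost all walks originating in `R`.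
Indeed, if a walk `q` ends in a sink or is long enough, then all ghost edges cancel in `u q`, so that
`u q = ∑ c_p p` with integers `c_p` and walks `p` ending in `T(q)`. Since `u` is unitary,
`(u q)* (u q) = q* q = T(q)`, and comparing coefficients of `T(q)` gives `∑ c_p² = 1`: exactly one
`c_p` is nonzero, and it is `±1` (`eq_smul_elt_of_mem_span`). The comparison of coefficients needs
an additive functional which is `1` on `T(q)` and `0` on the non-empty walks and their adjoints
(`exists_functional`). It is a diagonal coefficient of a concrete representation on functions on
`V × ℕ × ℤ`, in which the coordinate in `ℤ` records the degree.

The walks `p` with `u p = ± p'` for some walk `p'` with `T(p') = T(p)` therefore form a cofinite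
subspace, and `p ↦ p'` is a Higman-Thompson representative, whose inverse belongs to `u*`. This
defines a homomorphism `toHT` from the unitary group to the Higman-Thompson group. Two elements of
`L_ℤ(G, R)` are equal if they have the same products with the walks in a cofinite subspace
(`ext_of_mul_elt`). It follows that the kernel consists of the elements `∑ ± b b*`
(`mem_ker_toHT_iff`), and that every representative `φ` comes from the unitary element
`∑ φ(b) b*`, the sum over the basis of its domain (`toHT_surjective`).
-/

namespace DirGraph

variable {V E : Type*} {G : DirGraph V E} {R : V}

/-! ### A graded representation of the Leavitt path algebra and its diagonal coefficients -/

/-- If `G` is row-finite, then the sets `{v} × ℕ` can be decomposed along the outgoing edges of `v`: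
there are maps `c e : ℕ → ℕ` such that, for each `v` which is not a sink, `ℕ` is the disjoint union
of the injective images of the `c e` with `o e = v`. -/
theorem RowFinite.exists_branching (hG : G.RowFinite) :
    ∃ c : E → ℕ → ℕ, (∀ e, Function.Injective (c e)) ∧
      (∀ e e' m m', G.o e = G.o e' → c e m = c e' m' → e = e') ∧
      ∀ e n, ∃ e' m, G.o e' = G.o e ∧ c e' m = n := by
  have key : ∀ e₀ : E, Nonempty ({e // G.o e = G.o e₀} × ℕ ≃ ℕ) := by
    intro e₀
    have : Finite {e // G.o e = G.o e₀} := (hG (G.o e₀)).to_subtype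
    have : Nonempty {e // G.o e = G.o e₀} := ⟨⟨e₀, rfl⟩⟩
    obtain ⟨_⟩ := nonempty_denumerable ({e // G.o e = G.o e₀} × ℕ)
    exact ⟨Denumerable.eqv _⟩
  have key' : ∀ v : V, ∃ σ : {e // G.o e = v} × ℕ → ℕ,
      Function.Injective σ ∧ ((∃ e, G.o e = v) → Function.Surjective σ) := by
    intro v
    by_cases h : ∃ e, G.o e = v
    · obtain ⟨e₀, rfl⟩ := h
      obtain ⟨σ⟩ := key e₀
      exact ⟨σ, σ.injective, fun _ => σ.surjective⟩
    · exact ⟨fun _ => 0, fun x => (h ⟨x.1, x.1.2⟩).elim, fun h' => (h h').elim⟩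
  choose σ hσ hσ' using key'
  refine ⟨fun e m => σ (G.o e) (⟨e, rfl⟩, m), ?_, ?_, ?_⟩
  · intro e m m' h
    simpa using hσ _ h
  · intro e e' m m' ho h
    have aux : ∀ v (hv : G.o e' = v), σ (G.o e') (⟨e', rfl⟩, m') = σ v (⟨e', hv⟩, m') := by
      rintro v rfl
      rfl
    have h2 := hσ _ (h.trans (aux (G.o e) ho.symm))
    simpa using congrArg (fun x => (x.1 : E)) h2
  · intro e n
    obtain ⟨⟨⟨e', he'⟩, m⟩, h⟩ := hσ' (G.o e) ⟨e, rfl⟩ n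
    refine ⟨e', m, he', ?_⟩
    rw [← h]
    have aux : ∀ v (hv : G.o e' = v), σ (G.o e') (⟨e', rfl⟩, m) = σ v (⟨e', hv⟩, m) := by
      rintro v rfl
      rfl
    exact aux _ he'

open scoped Classical in
/-- The action of the generators of the Leavitt path algebra on the functions `V × ℕ × ℤ → ℤ`
defined by a family of maps `c e : ℕ → ℕ`: the vertex `v` is the restriction to `{v} × ℕ × ℤ`, the
edge `e` transports functions along `(t e, m, k) ↦ (o e, c e m, k + 1)` and extends them by `0`,
and `e*` transports them back. -/
noncomputable def genAction (G : DirGraph V E) (c : E → ℕ → ℕ) :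
    LPAGen V E → Module.End ℤ (V → ℕ → ℤ → ℤ)
  | .vertex v =>
    { toFun := fun f w n k => if w = v then f w n k else 0
      map_add' := fun f g => by ext w n k; by_cases h : w = v <;> simp [h]
      map_smul' := fun a f => by ext w n k; by_cases h : w = v <;> simp [h] }
  | .edge e =>
    { toFun := fun f w n k =>
        if w = G.o e then Function.extend (c e) (fun m => f (G.t e) m (k - 1)) 0 n else 0
      map_add' := fun f g => by
        ext w n k
        by_cases h : ∃ m, c e m = n <;> by_cases h' : w = G.o e <;> simp [Function.extend, h, h']
      map_smul' := fun a f => by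
        ext w n k
        by_cases h : ∃ m, c e m = n <;> by_cases h' : w = G.o e <;> simp [Function.extend, h, h'] }
  | .ghost e =>
    { toFun := fun f w n k => if w = G.t e then f (G.o e) (c e n) (k + 1) else 0
      map_add' := fun f g => by ext w n k; by_cases h : w = G.t e <;> simp [h]
      map_smul' := fun a f => by ext w n k; by_cases h : w = G.t e <;> simp [h] }

open scoped Classical in
theorem genAction_vertex (c : E → ℕ → ℕ) (v : V) (f : V → ℕ → ℤ → ℤ) (w : V) (n : ℕ) (k : ℤ) :
    genAction G c (.vertex v) f w n k = if w = v then f w n k else 0 := rfl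

open scoped Classical in
theorem genAction_edge (c : E → ℕ → ℕ) (e : E) (f : V → ℕ → ℤ → ℤ) (w : V) (n : ℕ) (k : ℤ) :
    genAction G c (.edge e) f w n k =
      if w = G.o e then Function.extend (c e) (fun m => f (G.t e) m (k - 1)) 0 n else 0 := rfl

open scoped Classical in
theorem genAction_ghost (c : E → ℕ → ℕ) (e : E) (f : V → ℕ → ℤ → ℤ) (w : V) (n : ℕ) (k : ℤ) :
    genAction G c (.ghost e) f w n k = if w = G.t e then f (G.o e) (c e n) (k + 1) else 0 := rfl

theorem genAction_rel {c : E → ℕ → ℕ} (h1 : ∀ e, Function.Injective (c e))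
    (h2 : ∀ e e' m m', G.o e = G.o e' → c e m = c e' m' → e = e')
    (h3 : ∀ e n, ∃ e' m, G.o e' = G.o e ∧ c e' m = n) (x y : FreeLPA V E) (h : LPARel G x y) :
    LPA.freeLift (genAction G c) x = LPA.freeLift (genAction G c) y := by
  classical
  induction h with
  | vertex_mul_self v =>
    refine LinearMap.ext fun f => ?_
    ext w n k
    simp only [map_mul, LPA.freeLift_genFree, Module.End.mul_apply, genAction_vertex]
    split_ifs <;> rfl
  | vertex_mul_ne v w h =>
    refine LinearMap.ext fun f => ?_
    ext w' n k
    simp only [map_mul, map_zero, LPA.freeLift_genFree, Module.End.mul_apply, genAction_vertex]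
    split_ifs with h' h''
    · exact absurd (h'.symm.trans h'') h
    all_goals rfl
  | ghost_mul_self e =>
    refine LinearMap.ext fun f => ?_
    ext w n k
    simp only [map_mul, LPA.freeLift_genFree, Module.End.mul_apply, genAction_vertex,
      genAction_edge, genAction_ghost, if_true, (h1 e).extend_apply, add_sub_cancel_right]
    split_ifs with h
    · rw [h]
    · rfl
  | ghost_mul_ne e e' h =>
    refine LinearMap.ext fun f => ?_
    ext w n k
    simp only [map_mul, map_zero, LPA.freeLift_genFree, Module.End.mul_apply,
      genAction_edge, genAction_ghost]
    split_ifs with h' h''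
    · rw [Function.extend_apply' _ _ _ (by
        rintro ⟨m, hm⟩
        exact h (h2 e e' n m h'' hm.symm))]
      rfl
    all_goals rfl
  | o_mul_edge e =>
    refine LinearMap.ext fun f => ?_
    ext w n k
    simp only [map_mul, LPA.freeLift_genFree, Module.End.mul_apply, genAction_vertex,
      genAction_edge]
    split_ifs <;> rfl
  | edge_mul_t e =>
    refine LinearMap.ext fun f => ?_
    ext w n k
    simp only [map_mul, LPA.freeLift_genFree, Module.End.mul_apply, genAction_vertex,
      genAction_edge, if_true]
  | t_mul_ghost e =>
    refine LinearMap.ext fun f => ?_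
    ext w n k
    simp only [map_mul, LPA.freeLift_genFree, Module.End.mul_apply, genAction_vertex,
      genAction_ghost]
    split_ifs <;> rfl
  | ghost_mul_o e =>
    refine LinearMap.ext fun f => ?_
    ext w n k
    simp only [map_mul, LPA.freeLift_genFree, Module.End.mul_apply, genAction_vertex,
      genAction_ghost, if_true]
  | sum_edge v s hs h =>
    refine LinearMap.ext fun f => ?_
    ext w n k
    obtain ⟨e₀, he₀⟩ := hs
    have hv := (h e₀).1 he₀
    obtain ⟨e₁, m, ho, rfl⟩ := h3 e₀ n
    have hs1 : e₁ ∈ s := (h e₁).2 (ho.trans hv)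
    rw [map_sum, LinearMap.sum_apply, Finset.sum_apply, Finset.sum_apply,
      Finset.sum_apply, Finset.sum_eq_single_of_mem e₁ hs1]
    · simp only [map_mul, LPA.freeLift_genFree, Module.End.mul_apply, genAction_vertex,
        genAction_edge, genAction_ghost, if_true, (h1 e₁).extend_apply, sub_add_cancel, ho, hv]
      split_ifs with h'
      · rw [h']
      · rfl
    · intro e he hne
      simp only [map_mul, LPA.freeLift_genFree, Module.End.mul_apply, genAction_edge]
      split_ifs
      · rw [Function.extend_apply' _ _ _ (by
          rintro ⟨m', hm'⟩
          exact hne (h2 e e₁ m' m (((h e).1 he).trans ((h e₁).1 hs1).symm) hm'))]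
        rfl
      · rfl

namespace LPA

/-- For every vertex `v` there is an additive functional on the Leavitt path algebra
that is `1` on `v` and vanishes on all non-empty walks and their adjoints. It is a diagonal
coefficient of a representation on the functions on `V × ℕ × ℤ`, where the coordinate in `ℤ` keeps
track of the degree. -/
theorem exists_functional (hG : G.RowFinite) (v : V) :
    ∃ τ : LPA G →+ ℤ, τ (vert G v) = 1 ∧
      ∀ w l, l ≠ [] → τ (word G w l) = 0 ∧ τ (star (word G w l)) = 0 := by
  classical
  obtain ⟨c, h1, h2, h3⟩ := hG.exists_branching
  let ρ : LPA G →ₙ+* Module.End ℤ (V → ℕ → ℤ → ℤ) :=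
    lift (genAction G c) (genAction_rel h1 h2 h3)
  have hv : ∀ v, ρ (vert G v) = genAction G c (.vertex v) := fun v => lift_gen _ _ _
  have he : ∀ e, ρ (edge G e) = genAction G c (.edge e) := fun e => lift_gen _ _ _
  have hg : ∀ e, ρ (ghost G e) = genAction G c (.ghost e) := fun e => lift_gen _ _ _
  -- Walks raise the degree by their length.
  have hword : ∀ l w f j, (∀ w n k, k ≠ j → f w n k = 0) →
      ∀ w' n k, k ≠ j + (l.length : ℤ) → ρ (word G w l) f w' n k = 0 := by
    intro l
    induction l with
    | nil =>
      intro w f j hf w' n k hk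
      simp only [word, hv, genAction_vertex]
      rw [hf _ _ _ (by simpa using hk), ite_self]
    | cons e l ih =>
      intro w f j hf w' n k hk
      simp only [word, map_mul, Module.End.mul_apply, he, genAction_edge]
      split_ifs
      · by_cases hn : ∃ m, c e m = n
        · obtain ⟨m, rfl⟩ := hn
          rw [(h1 e).extend_apply]
          refine ih _ f j hf _ _ _ fun hk' => hk ?_
          rw [List.length_cons]
          push_cast
          linarith
        · rw [Function.extend_apply' _ _ _ hn]
          rfl
      · rfl
  have hstar : ∀ l w f j, (∀ w n k, k ≠ j → f w n k = 0) →
      ∀ w' n k, k ≠ j - (l.length : ℤ) → ρ (star (word G w l)) f w' n k = 0 := by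
    intro l
    induction l with
    | nil =>
      intro w f j hf w' n k hk
      simp only [word, star_vert, hv, genAction_vertex]
      rw [hf _ _ _ (by simpa using hk), ite_self]
    | cons e l ih =>
      intro w f j hf w' n k hk
      simp only [word, star_mul, star_edge, map_mul, Module.End.mul_apply, hg]
      refine ih _ _ (j - 1) (fun w n k hk => ?_) _ _ _ fun hk' => hk ?_
      · rw [genAction_ghost, hf _ _ _ fun hk' => hk (by linarith), ite_self]
      · rw [hk', List.length_cons]
        push_cast
        ring
  let δ : V → ℕ → ℤ → ℤ := fun w _ k => if w = v ∧ k = 0 then 1 else 0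
  have hδ : ∀ w n k, k ≠ 0 → δ w n k = 0 := fun w n k hk => if_neg fun h => hk h.2
  let τ : LPA G →+ ℤ :=
    { toFun := fun a => ρ a δ v 0 0
      map_zero' := by simp
      map_add' := fun a b => by simp }
  refine ⟨τ, ?_, fun w l hl => ⟨?_, ?_⟩⟩
  · change ρ (vert G v) δ v 0 0 = 1
    simp [hv, genAction_vertex, δ]
  · refine hword l w δ 0 hδ v 0 0 fun h => hl ?_
    simpa [eq_comm] using h
  · refine hstar l w δ 0 hδ v 0 0 fun h => hl ?_
    simpa [eq_comm] using h

end LPA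

/-! ### Walks in the Leavitt path algebra -/

theorem LPA.star_word_mul_self {v : V} {l : List E} (hl : G.IsWalk v l) :
    star (LPA.word G v l) * LPA.word G v l = LPA.vert G (G.terminus v l) := by
  induction l generalizing v with
  | nil => rw [LPA.word, LPA.star_vert, LPA.vert_mul_self]; rfl
  | cons e l ih =>
    simp only [LPA.word, star_mul, LPA.star_edge]
    rw [mul_assoc, ← mul_assoc (LPA.ghost G e), LPA.ghost_mul_self, LPA.vert_mul_word hl.2,
      ih hl.2]
    rfl

namespace WalksFrom

/-- The empty walk. -/
def nil : WalksFrom G R := ⟨[], trivial⟩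

/-- The walk `q` followed by an edge `e` originating in `T(q)`. -/
def snoc (q : WalksFrom G R) (e : E) (h : G.o e = q.T) : WalksFrom G R :=
  q.append ⟨[e], h, trivial⟩

theorem eq_nil_or_eq_snoc (p : WalksFrom G R) : p = nil ∨ ∃ q e h, p = snoc q e h := by
  obtain ⟨l, hl⟩ := p
  rcases List.eq_nil_or_concat' l with rfl | ⟨m, e, rfl⟩
  · exact Or.inl rfl
  · rw [isWalk_append] at hl
    exact Or.inr ⟨⟨m, hl.1⟩, e, hl.2.1, rfl⟩

theorem length_snoc (q : WalksFrom G R) (e : E) (h : G.o e = q.T) :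
    (q.snoc e h).edges.length = q.edges.length + 1 :=
  List.length_append

theorem lt_snoc (q : WalksFrom G R) (e : E) (h : G.o e = q.T) : q < q.snoc e h := by
  refine lt_of_le_of_ne ⟨[e], rfl⟩ fun h' => ?_
  have := q.length_snoc e h
  rw [← h'] at this
  omega

theorem le_or_le_of_le {p q r : WalksFrom G R} (hp : p ≤ r) (hq : q ≤ r) : p ≤ q ∨ q ≤ p :=
  List.prefix_or_prefix_of_prefix hp hq

theorem elt_snoc (q : WalksFrom G R) (e : E) (h : G.o e = q.T) :
    (q.snoc e h).elt = q.elt * LPA.edge G e := by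
  rw [snoc, elt_append]
  change _ * (LPA.edge G e * LPA.vert G (G.t e)) = _
  rw [LPA.edge_mul_t]

theorem elt_mul_vert (p : WalksFrom G R) : p.elt * LPA.vert G p.T = p.elt :=
  LPA.word_mul_vert G R p.edges

theorem star_elt_mul_self (p : WalksFrom G R) : star p.elt * p.elt = LPA.vert G p.T :=
  LPA.star_word_mul_self p.isWalk

theorem star_elt_mul_eq_zero {p q : WalksFrom G R} (h : ¬ p ≤ q) (h' : ¬ q ≤ p) :
    star p.elt * q.elt = 0 := by
  rcases LPA.star_word_mul_word p.isWalk q.isWalk with h0 | ⟨r, hr, -⟩ | ⟨r, hr, -⟩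
  · exact h0
  · exact absurd ⟨r, hr.symm⟩ h
  · exact absurd ⟨r, hr.symm⟩ h'

/-- The walks ending in `v` are orthonormal with respect to a suitable functional. -/
theorem exists_orthonormal (hG : G.RowFinite) (R v : V) :
    ∃ τ : LPA G →+ ℤ, τ (LPA.vert G v) = 1 ∧
      (∀ p : WalksFrom G R, p.T = v → τ (star p.elt * p.elt) = 1) ∧
      ∀ p q : WalksFrom G R, p ≠ q → τ (star p.elt * q.elt) = 0 := by
  obtain ⟨τ, h1, h2⟩ := LPA.exists_functional hG v
  refine ⟨τ, h1, ?_, fun p q hpq => ?_⟩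
  · rintro p rfl
    rw [star_elt_mul_self, h1]
  · rcases LPA.star_word_mul_word p.isWalk q.isWalk with h | ⟨r, hr, -, h⟩ | ⟨r, hr, -, h⟩
    · exact (congrArg τ h).trans (map_zero τ)
    · refine (congrArg τ h).trans (h2 _ r ?_).1
      rintro rfl
      exact hpq (WalksFrom.ext (by simpa using hr.symm))
    · refine (congrArg τ h).trans (h2 _ r ?_).2
      rintro rfl
      exact hpq (WalksFrom.ext (by simpa using hr))

theorem eq_of_smul_elt_eq (hG : G.RowFinite) {p q : WalksFrom G R} {κ κ' : ℤˣ}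
    (h : (κ : ℤ) • p.elt = (κ' : ℤ) • q.elt) : p = q := by
  obtain ⟨τ, -, h1, h2⟩ := exists_orthonormal hG R p.T
  by_contra hpq
  have h3 := congrArg (fun x => τ (star p.elt * x)) h
  simp only [mul_smul_comm, map_zsmul, h1 p rfl, h2 p q hpq, smul_eq_mul, mul_one] at h3
  exact κ.ne_zero (h3.trans (mul_zero _))

/-- An isometry which is an integral combination of walks is a walk up to sign: the
coefficients are integers whose squares add up to `1`. -/
theorem eq_smul_elt_of_mem_span (hG : G.RowFinite) {v : V} {w : LPA G}
    (hw : w ∈ Submodule.span ℤ (elt '' {p : WalksFrom G R | p.T = v}))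
    (h : star w * w = LPA.vert G v) :
    ∃ (p : WalksFrom G R) (κ : ℤˣ), p.T = v ∧ w = (κ : ℤ) • p.elt := by
  obtain ⟨τ, h0, h1, h2⟩ := exists_orthonormal hG R v
  obtain ⟨c, hc, rfl⟩ := (Finsupp.mem_span_image_iff_linearCombination ℤ).1 hw
  rw [Finsupp.mem_supported] at hc
  have hsum : ∑ p ∈ c.support, c p * c p = 1 := by
    have h3 := congrArg τ h
    rw [h0] at h3
    rw [← h3, Finsupp.linearCombination_apply, Finsupp.sum, star_sum, Finset.sum_mul, map_sum]
    refine Finset.sum_congr rfl fun q hq => ?_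
    rw [Finset.mul_sum, map_sum, Finset.sum_eq_single_of_mem q hq]
    · rw [star_zsmul, smul_mul_smul_comm, map_zsmul, h1 q (hc hq), smul_eq_mul, mul_one]
    · intro r hr hrq
      rw [star_zsmul, smul_mul_smul_comm, map_zsmul, h2 q r hrq.symm, smul_zero]
  obtain ⟨p, hp⟩ : c.support.Nonempty := by
    by_contra hne
    rw [Finset.not_nonempty_iff_eq_empty.1 hne] at hsum
    simp at hsum
  have hp0 : c p ≠ 0 := Finsupp.mem_support_iff.1 hp
  have hle : ∀ q ∈ c.support, q = p := by
    intro q hq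
    by_contra hqp
    have h4 := Finset.add_le_sum (f := fun p => c p * c p) (s := c.support)
      (fun i _ => mul_self_nonneg (c i)) hq hp hqp
    have h5 := mul_self_pos.2 hp0
    have h6 := mul_self_pos.2 (Finsupp.mem_support_iff.1 hq)
    omega
  have hs : c.support = {p} := Finset.eq_singleton_iff_unique_mem.2 ⟨hp, hle⟩
  rw [hs, Finset.sum_singleton] at hsum
  refine ⟨p, ⟨c p, c p, hsum, hsum⟩, hc hp, ?_⟩
  rw [Finsupp.linearCombination_apply, Finsupp.sum, hs, Finset.sum_singleton]

/-- If the `g i` are pairwise incomparable, then `∑ κ_i f_i g_i*` sends `g i` to `κ_i f_i`. -/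
theorem sum_mul_elt {ι : Type*} (B : Finset ι) (κ : ι → ℤ) (f g : ι → WalksFrom G R)
    (hg : ∀ i ∈ B, ∀ j ∈ B, g i ≤ g j → i = j) (hT : ∀ i ∈ B, (f i).T = (g i).T)
    {i : ι} (hi : i ∈ B) :
    (∑ j ∈ B, κ j • ((f j).elt * star (g j).elt)) * (g i).elt = κ i • (f i).elt := by
  rw [Finset.sum_mul, Finset.sum_eq_single_of_mem i hi]
  · rw [smul_mul_assoc, mul_assoc, star_elt_mul_self, ← hT i hi, elt_mul_vert]
  · intro j hj hji
    rw [smul_mul_assoc, mul_assoc, star_elt_mul_eq_zero (fun h => hji (hg j hj i hi h))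
      (fun h => hji (hg i hi j hj h).symm), mul_zero, smul_zero]

end WalksFrom

/-! ### Cofinite subspaces and bases of the unfolding tree -/

namespace WalksFrom

theorem finite_snoc (hG : G.RowFinite) {F : Set (WalksFrom G R)} (hF : F.Finite) :
    {p : WalksFrom G R | ∃ q ∈ F, ∃ e h, p = q.snoc e h}.Finite := by
  have : {p : WalksFrom G R | ∃ q ∈ F, ∃ e h, p = q.snoc e h} =
      ⋃ q ∈ F, ⋃ e ∈ {e | G.o e = q.T}, {p | ∃ h, p = q.snoc e h} := by
    ext p
    simp
  rw [this]
  refine hF.biUnion fun q _ => (hG q.T).biUnion fun e _ => Set.Subsingleton.finite ?_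
  rintro _ ⟨_, rfl⟩ _ ⟨_, rfl⟩
  rfl

theorem finite_length_lt (hG : G.RowFinite) (N : ℕ) :
    {p : WalksFrom G R | p.edges.length < N}.Finite := by
  induction N with
  | zero => simp
  | succ N ih =>
    refine ((Set.finite_singleton nil).union (finite_snoc hG ih)).subset fun p hp => ?_
    rcases p.eq_nil_or_eq_snoc with rfl | ⟨q, e, h, rfl⟩
    · exact Or.inl rfl
    · refine Or.inr ⟨q, ?_, e, h, rfl⟩
      rw [Set.mem_ofPred_eq, length_snoc] at hp
      exact Nat.lt_of_succ_lt_succ hp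

theorem snoc_le_of_lt {p q : WalksFrom G R} (h : p < q) : ∃ e he, p.snoc e he ≤ q := by
  obtain ⟨⟨l, hl⟩, rfl⟩ := le_iff_exists_append.1 h.le
  cases l with
  | nil => exact absurd (WalksFrom.ext (by simp [append])) h.ne
  | cons e l => exact ⟨e, hl.1, l, by simp [snoc, append]⟩

/-- Maximal walks (those ending in a sink) have to be included, since a maximal walk lies below no
other element of `S`. -/
theorem isCofiniteSubspace_of_length (hG : G.RowFinite) {S : Set (WalksFrom G R)}
    (hS : ∀ p ∈ S, ∀ q, p ≤ q → q ∈ S) (N : ℕ)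
    (hN : ∀ p : WalksFrom G R, N ≤ p.edges.length ∨ IsMax p → p ∈ S) : IsCofiniteSubspace S where
  finite_compl := (finite_length_lt hG N).subset fun p hp => by
    by_contra h
    exact hp (hN p (Or.inl (not_lt.1 h)))
  upper p hp q hq := hS p hp q hq
  inescapable p := by
    induction hn : N - p.edges.length generalizing p with
    | zero => exact ⟨p, hN p (Or.inl (Nat.le_of_sub_eq_zero hn)), le_rfl⟩
    | succ n ih =>
      by_cases hp : IsMax p
      · exact ⟨p, hN p (Or.inr hp), le_rfl⟩
      · obtain ⟨q, hq⟩ := not_isMax_iff.1 hp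
        obtain ⟨e, he, -⟩ := snoc_le_of_lt hq
        obtain ⟨r, hr, hr'⟩ := ih (p.snoc e he) (by rw [length_snoc]; omega)
        exact ⟨r, hr, (lt_snoc p e he).le.trans hr'⟩

theorem finite_basisOf (hG : G.RowFinite) {S : Set (WalksFrom G R)} (hS : IsCofiniteSubspace S) :
    (basisOf S).Finite := by
  refine ((Set.finite_singleton nil).union (finite_snoc hG hS.finite_compl)).subset fun p hp => ?_
  rcases p.eq_nil_or_eq_snoc with rfl | ⟨q, e, h, rfl⟩
  · exact Or.inl rfl
  · exact Or.inr ⟨q, fun hq => hp.not_lt hq (lt_snoc q e h), e, h, rfl⟩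

theorem isTreeBasis_of_coe_eq_basisOf {S : Set (WalksFrom G R)} (hS : IsCofiniteSubspace S)
    {B : Finset (WalksFrom G R)} (hB : (B : Set (WalksFrom G R)) = basisOf S) : IsTreeBasis B := by
  refine ⟨?_, fun C hC hBC p hp => ?_⟩
  · change IsAntichain (· ≤ ·) (B : Set (WalksFrom G R))
    rw [hB]
    exact setOfPred_minimal_antichain _
  · obtain ⟨q, hq, hpq⟩ := hS.inescapable p
    obtain ⟨b, hb, hbq⟩ := exists_basisOf_le hq
    have hbB : b ∈ B := by rwa [← Finset.mem_coe, hB]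
    rcases le_or_le_of_le hbq hpq with h | h
    · rwa [← hC.eq (hBC hbB) hp h]
    · rwa [hC.eq hp (hBC hbB) h]

theorem le_or_le_of_isTreeBasis {B : Finset (WalksFrom G R)} (hB : IsTreeBasis B)
    (p : WalksFrom G R) : ∃ b ∈ B, b ≤ p ∨ p ≤ b := by
  classical
  by_contra! h
  have hC : IsAntichain (· ≤ ·) ((insert p B : Finset (WalksFrom G R)) : Set (WalksFrom G R)) := by
    rw [Finset.coe_insert]
    exact hB.1.insert (fun b hb _ => (h b hb).1) fun b hb _ => (h b hb).2
  have := hB.2 hC (Finset.subset_insert p B) (Finset.mem_insert_self p B)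
  exact (h p this).1 le_rfl

theorem finite_Iic (p : WalksFrom G R) : (Set.Iic p).Finite := by
  refine Set.Finite.of_finite_image (f := edges) ?_ fun _ _ _ _ h => WalksFrom.ext h
  refine (List.finite_toSet p.edges.inits).subset ?_
  rintro _ ⟨q, hq, rfl⟩
  exact (List.mem_inits _ _).2 hq

/-- The walks that have a prefix in a given basis form a cofinite subspace. -/
theorem isCofiniteSubspace_upperClosure {B : Finset (WalksFrom G R)} (hB : IsTreeBasis B) :
    IsCofiniteSubspace {p : WalksFrom G R | ∃ b ∈ B, b ≤ p} where
  finite_compl := by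
    refine (B.finite_toSet.biUnion fun b _ => finite_Iic b).subset fun p hp => ?_
    obtain ⟨b, hb, h | h⟩ := le_or_le_of_isTreeBasis hB p
    · exact absurd ⟨b, hb, h⟩ hp
    · exact Set.mem_biUnion hb h
  upper := fun _ ⟨b, hb, h⟩ _ hq => ⟨b, hb, h.trans hq⟩
  inescapable p := by
    obtain ⟨b, hb, h | h⟩ := le_or_le_of_isTreeBasis hB p
    · exact ⟨p, ⟨b, hb, h⟩, le_rfl⟩
    · exact ⟨b, ⟨b, hb, le_rfl⟩, h⟩

/-- An element of the Leavitt path algebra that kills all walks in a cofinite subspace kills all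
walks: at a longest walk `q` which is not killed, `a q = ∑ a q e e*`. -/
theorem mul_elt_eq_zero (hG : G.RowFinite) {S : Set (WalksFrom G R)} (hS : IsCofiniteSubspace S)
    {a : LPA G} (ha : ∀ q ∈ S, a * q.elt = 0) (q : WalksFrom G R) : a * q.elt = 0 := by
  by_contra hq
  obtain ⟨p, hp, hmax⟩ := Set.exists_max_image {p : WalksFrom G R | a * p.elt ≠ 0}
    (fun p => p.edges.length) (hS.finite_compl.subset fun p hp h => hp (ha p h)) ⟨q, hq⟩
  have hsnoc : ∀ e h, a * (p.snoc e h).elt = 0 := by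
    intro e h
    by_contra hne
    have := hmax _ hne
    rw [length_snoc] at this
    omega
  obtain ⟨r, hr, hpr⟩ := hS.inescapable p
  obtain ⟨e, he, -⟩ := snoc_le_of_lt (lt_of_le_of_ne hpr (by
    rintro rfl
    exact hp (ha _ hr)))
  refine hp ?_
  rw [← elt_mul_vert p, LPA.sum_edge G p.T (hG p.T).toFinset ⟨e, (hG p.T).mem_toFinset.2 he⟩
    fun e => (hG p.T).mem_toFinset, Finset.mul_sum, Finset.mul_sum]
  refine Finset.sum_eq_zero fun e he => ?_
  rw [← mul_assoc, ← mul_assoc, mul_assoc a, ← elt_snoc p e ((hG p.T).mem_toFinset.1 he), hsnoc,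
    zero_mul]

end WalksFrom

theorem RootedLPA.ext_of_mul_elt (hG : G.RowFinite) {S : Set (WalksFrom G R)}
    (hS : IsCofiniteSubspace S) {x y : RootedLPA G R}
    (h : ∀ q ∈ S, x.val * q.elt = y.val * q.elt) : x = y := by
  have h0 := WalksFrom.mul_elt_eq_zero hG hS (a := x.val - y.val)
    (fun q hq => by rw [sub_mul, h q hq, sub_self]) WalksFrom.nil
  change (x.val - y.val) * LPA.vert G R = 0 at h0
  refine RootedLPA.val_injective ?_
  rw [sub_mul, sub_eq_zero] at h0
  exact (mul_vert_of_mem x.2).symm.trans (h0.trans (mul_vert_of_mem y.2))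

/-! ### The action of unitary elements on walks -/

namespace RootedLPA

theorem exists_val_eq {a : LPA G} (ha : a ∈ rootedSpan G R) : ∃ x : RootedLPA G R, x.val = a :=
  ⟨⟨a, ha⟩, rfl⟩

/-- `x.Carries p q`: the product `x p` is, up to sign, the walk `q`, and `q` ends where `p` does. -/
def Carries (x : RootedLPA G R) (p q : WalksFrom G R) : Prop :=
  q.T = p.T ∧ ∃ κ : ℤˣ, x.val * p.elt = (κ : ℤ) • q.elt

namespace Carries

variable {x y : RootedLPA G R} {p q r : WalksFrom G R}

theorem unique (hG : G.RowFinite) (h : x.Carries p q) (h' : x.Carries p r) : q = r := by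
  obtain ⟨-, κ, h⟩ := h
  obtain ⟨-, κ', h'⟩ := h'
  exact WalksFrom.eq_of_smul_elt_eq hG (h.symm.trans h')

theorem mul (h : x.Carries q r) (h' : y.Carries p q) : (x * y).Carries p r := by
  obtain ⟨hT, κ, h⟩ := h
  obtain ⟨hT', κ', h'⟩ := h'
  refine ⟨hT.trans hT', κ * κ', ?_⟩
  rw [val_mul, mul_assoc, h', mul_smul_comm, h, smul_smul, Units.val_mul, mul_comm]

theorem star (hx : star x * x = 1) (h : x.Carries p q) : (star x).Carries q p := by
  obtain ⟨hT, κ, h⟩ := h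
  refine ⟨hT.symm, κ, ?_⟩
  have h1 : (κ : ℤ) • (x.val * p.elt) = q.elt := by
    rw [h, smul_smul, Int.units_coe_mul_self, one_smul]
  have h2 : (Star.star x).val * x.val = LPA.vert G R := by rw [← val_mul, hx, val_one]
  rw [← h1, mul_smul_comm, ← mul_assoc, h2]
  exact congrArg _ (LPA.vert_mul_word p.isWalk)

/-- A walk `r` at the end of `p` can be added on both sides, with the same sign. -/
theorem append (h : x.Carries p q) (r : WalksFrom G p.T) :
    ∃ q', q'.edges = q.edges ++ r.edges ∧ x.Carries (p.append r) q' ∧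
      ∀ κ : ℤ, x.val * p.elt = κ • q.elt → x.val * (p.append r).elt = κ • q'.elt := by
  obtain ⟨hT, κ, h⟩ := h
  have hr : G.IsWalk q.T r.edges := by rw [hT]; exact r.isWalk
  have key : ∀ κ : ℤ, x.val * p.elt = κ • q.elt →
      x.val * (p.append r).elt = κ • (q.append ⟨r.edges, hr⟩).elt := by
    intro κ h
    rw [elt_append, ← mul_assoc, h, smul_mul_assoc, elt_append]
    change κ • (q.elt * LPA.word G p.T r.edges) = κ • (q.elt * LPA.word G q.T r.edges)
    rw [hT]
  refine ⟨q.append ⟨r.edges, hr⟩, rfl, ⟨?_, κ, key _ h⟩, key⟩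
  rw [append_T, append_T]
  change G.terminus q.T r.edges = G.terminus p.T r.edges
  rw [hT]

end Carries

/-- For all sufficiently long walks `q`, and for all `q` ending in a sink, `x q` is a combination of
walks (without ghost edges) ending where `q` does. -/
theorem exists_mul_elt_mem_span {a : LPA G} (ha : a ∈ rootedSpan G R) :
    ∃ N, ∀ q : WalksFrom G R, N ≤ q.edges.length ∨ IsMax q →
      a * q.elt ∈ Submodule.span ℤ (WalksFrom.elt '' {p : WalksFrom G R | p.T = q.T}) := by
  induction ha using Submodule.span_induction with
  | zero => exact ⟨0, fun q _ => by rw [zero_mul]; exact zero_mem _⟩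
  | add a b _ _ h h' =>
    obtain ⟨N, h⟩ := h
    obtain ⟨N', h'⟩ := h'
    refine ⟨max N N', fun q hq => ?_⟩
    rw [add_mul]
    exact add_mem (h q (hq.imp_left (le_max_left _ _).trans))
      (h' q (hq.imp_left (le_max_right _ _).trans))
  | smul c a _ h =>
    obtain ⟨N, h⟩ := h
    refine ⟨N, fun q hq => ?_⟩
    rw [smul_mul_assoc]
    exact Submodule.smul_mem _ c (h q hq)
  | mem a ha =>
    obtain ⟨p, s, hT, rfl⟩ := ha
    refine ⟨s.edges.length, fun q hq => ?_⟩
    by_cases hsq : s ≤ q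
    · obtain ⟨r, rfl⟩ := WalksFrom.le_iff_exists_append.1 hsq
      have hr : G.IsWalk p.T r.edges := by rw [hT]; exact r.isWalk
      refine Submodule.subset_span ⟨p.append ⟨r.edges, hr⟩, ?_, ?_⟩
      · change (p.append ⟨r.edges, hr⟩).T = (s.append r).T
        rw [append_T, append_T]
        change G.terminus p.T r.edges = G.terminus s.T r.edges
        rw [hT]
      · rw [elt_append, elt_append, mul_assoc, ← mul_assoc (star s.elt),
          WalksFrom.star_elt_mul_self]
        change _ = p.elt * (LPA.vert G s.T * LPA.word G s.T r.edges)
        rw [LPA.vert_mul_word r.isWalk]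
        exact congrArg (fun v => p.elt * LPA.word G v r.edges) hT
    · have hqs : ¬ q ≤ s := fun h => by
        rcases hq with hq | hq
        · exact hsq (WalksFrom.ext (List.IsPrefix.eq_of_length_le h hq)).ge
        · exact hsq (hq h)
      rw [mul_assoc, WalksFrom.star_elt_mul_eq_zero hsq hqs, mul_zero]
      exact zero_mem _

theorem isCofiniteSubspace_carries (hG : G.RowFinite) {x : RootedLPA G R} (hx : star x * x = 1) :
    IsCofiniteSubspace {p | ∃ q, x.Carries p q} := by
  obtain ⟨N, hN⟩ := exists_mul_elt_mem_span x.2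
  refine WalksFrom.isCofiniteSubspace_of_length hG ?_ N fun p hp => ?_
  · rintro p ⟨q, hq⟩ _ hp'
    obtain ⟨r, rfl⟩ := WalksFrom.le_iff_exists_append.1 hp'
    obtain ⟨q', -, h, -⟩ := hq.append r
    exact ⟨q', h⟩
  · have h2 : (star x).val * x.val = LPA.vert G R := by rw [← val_mul, hx, val_one]
    obtain ⟨q, κ, hT, h⟩ := WalksFrom.eq_smul_elt_of_mem_span hG (hN p hp) (by
      change star (x.val * p.elt) * (x.val * p.elt) = _
      rw [star_mul, ← val_star, mul_assoc, ← mul_assoc (star x).val, h2,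
        ← WalksFrom.star_elt_mul_self]
      exact congrArg _ (LPA.vert_mul_word p.isWalk))
    exact ⟨q, hT, κ, h⟩

open scoped Classical in
/-- The walk `q` with `x p = ± q` and `T(q) = T(p)`, if there is one, and the junk value `p`
otherwise. -/
noncomputable def act (x : RootedLPA G R) (p : WalksFrom G R) : WalksFrom G R :=
  if h : ∃ q, x.Carries p q then h.choose else p

theorem carries_act {x : RootedLPA G R} {p : WalksFrom G R} (h : ∃ q, x.Carries p q) :
    x.Carries p (x.act p) := by
  rw [act, dif_pos h]
  exact h.choose_spec

theorem Carries.act_eq (hG : G.RowFinite) {x : RootedLPA G R} {p q : WalksFrom G R}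
    (h : x.Carries p q) : x.act p = q :=
  (carries_act ⟨q, h⟩).unique hG h

theorem act_le_act (hG : G.RowFinite) {x : RootedLPA G R} {p q : WalksFrom G R}
    (h : ∃ r, x.Carries p r) (hpq : p ≤ q) : x.act p ≤ x.act q := by
  obtain ⟨r, rfl⟩ := WalksFrom.le_iff_exists_append.1 hpq
  obtain ⟨q', h1, h2, -⟩ := (carries_act h).append r
  rw [h2.act_eq hG]
  exact ⟨r.edges, h1.symm⟩

/-- The almost automorphism `p ↦ ± u p` defined by a unitary element `u`. -/
noncomputable def toRep (hG : G.RowFinite) (u : unitary (RootedLPA G R)) :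
    AlmostAutRep (WalksFrom G R) where
  toFun := act u.1
  invFun := act (star u.1)
  source := {p | ∃ q, u.1.Carries p q}
  target := {p | ∃ q, (star u.1).Carries p q}
  map_source' p hp := ⟨p, (carries_act hp).star (Unitary.star_mul_self_of_mem u.2)⟩
  map_target' p hp := ⟨p, by
    simpa using (carries_act hp).star (by simp)⟩
  left_inv' p hp := ((carries_act hp).star (Unitary.star_mul_self_of_mem u.2)).act_eq hG
  right_inv' p hp := Carries.act_eq hG (by
    simpa using (carries_act hp).star (by simp))
  source_cofinite := isCofiniteSubspace_carries hG (Unitary.star_mul_self_of_mem u.2)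
  target_cofinite :=
    isCofiniteSubspace_carries hG (by simp)
  map_le_map_iff p hp q hq := by
    refine ⟨fun h => ?_, act_le_act hG hp⟩
    have hp' := (carries_act hp).star (Unitary.star_mul_self_of_mem u.2)
    have hq' := (carries_act hq).star (Unitary.star_mul_self_of_mem u.2)
    have := act_le_act hG ⟨p, hp'⟩ h
    rwa [hp'.act_eq hG, hq'.act_eq hG] at this

theorem isHTRep_toRep (hG : G.RowFinite) (u : unitary (RootedLPA G R)) :
    IsHTRep (toRep hG u) := by
  intro p hp
  have h := carries_act hp.1
  refine ⟨h.1, fun r => ?_⟩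
  obtain ⟨q, h1, h2, -⟩ := h.append r
  exact (congrArg WalksFrom.edges (h2.act_eq hG)).trans h1

theorem mk_toRep_eq_mk (hG : G.RowFinite) (u : unitary (RootedLPA G R))
    (φ : AlmostAutRep (WalksFrom G R)) {S : Set (WalksFrom G R)} (hS : IsCofiniteSubspace S)
    (hSφ : S ⊆ φ.source) (h : ∀ p ∈ S, u.1.Carries p (φ.toPartialEquiv p)) :
    AlmostAut.mk (toRep hG u) = AlmostAut.mk φ :=
  Quotient.sound ⟨S, hS, fun p hp => ⟨_, h p hp⟩, hSφ, fun p hp => (h p hp).act_eq hG⟩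

/-- The homomorphism from the unitary group to the Higman-Thompson group that
sends `u` to the class of `p ↦ ± u p`. -/
noncomputable def toHT (hG : G.RowFinite) : unitary (RootedLPA G R) →* HT G R :=
  MonoidHom.mk' (fun u => ⟨AlmostAut.mk (toRep hG u), toRep hG u, isHTRep_toRep hG u, rfl⟩) (by
    intro u v
    refine Subtype.ext ?_
    change _ = AlmostAut.mk ((toRep hG u).comp (toRep hG v))
    refine mk_toRep_eq_mk hG _ _ ((toRep hG u).comp (toRep hG v)).source_cofinite subset_rfl ?_
    intro p hp
    have hp' := (PartialEquiv.trans_source _ _).le hp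
    exact (carries_act hp'.2).mul (carries_act hp'.1))

end RootedLPA

namespace RootedLPA

/-! ### The kernel: diagonal unitary elements -/

theorem mul_elt_of_le {x : RootedLPA G R} {b p : WalksFrom G R} {κ : ℤ}
    (h : x.val * b.elt = κ • b.elt) (hbp : b ≤ p) : x.val * p.elt = κ • p.elt := by
  obtain ⟨r, rfl⟩ := WalksFrom.le_iff_exists_append.1 hbp
  rw [elt_append, ← mul_assoc, h, smul_mul_assoc]

theorem mul_elt_of_val_eq_sum {x : RootedLPA G R} {B : Finset (WalksFrom G R)}
    {κ : WalksFrom G R → ℤ} (hB : IsTreeBasis B)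
    (hx : x.val = ∑ b ∈ B, κ b • (b.elt * star b.elt)) {b p : WalksFrom G R} (hb : b ∈ B)
    (hbp : b ≤ p) : x.val * p.elt = κ b • p.elt := by
  refine mul_elt_of_le ?_ hbp
  rw [hx]
  exact WalksFrom.sum_mul_elt B κ id id (fun i hi j hj h => hB.1.eq hi hj h) (fun _ _ => rfl) hb

theorem star_eq_self_of_mem_DU {x : RootedLPA G R} (hx : x ∈ DU G R) : star x = x := by
  obtain ⟨B, κ, -, hx⟩ := hx
  refine val_injective ?_
  rw [val_star, hx, star_sum]
  refine Finset.sum_congr rfl fun b _ => ?_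
  rw [star_zsmul, star_mul, star_star]

theorem mul_self_of_mem_DU (hG : G.RowFinite) {x : RootedLPA G R} (hx : x ∈ DU G R) :
    x * x = 1 := by
  obtain ⟨B, κ, hB, hx⟩ := hx
  refine ext_of_mul_elt hG (WalksFrom.isCofiniteSubspace_upperClosure hB) ?_
  rintro p ⟨b, hb, hbp⟩
  have h := mul_elt_of_val_eq_sum hB hx hb hbp
  rw [val_mul, mul_assoc, h, mul_smul_comm, h, smul_smul, Int.units_coe_mul_self, one_smul, val_one]
  exact (LPA.vert_mul_word p.isWalk).symm

theorem mem_unitary_of_mem_DU (hG : G.RowFinite) {x : RootedLPA G R} (hx : x ∈ DU G R) :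
    x ∈ unitary (RootedLPA G R) := by
  have h := mul_self_of_mem_DU hG hx
  rw [Unitary.mem_iff, star_eq_self_of_mem_DU hx]
  exact ⟨h, h⟩

theorem mem_ker_toHT_iff (hG : G.RowFinite) (u : unitary (RootedLPA G R)) :
    u ∈ (toHT hG).ker ↔ u.1 ∈ DU G R := by
  rw [MonoidHom.mem_ker]
  constructor
  · intro h
    have h' : AlmostAut.mk (toRep hG u) = AlmostAut.mk AlmostAutRep.refl := congrArg Subtype.val h
    obtain ⟨S, hS, hSu, -, hS1⟩ := Quotient.exact h'
    have hκ : ∀ p : WalksFrom G R, ∃ κ : ℤˣ, p ∈ S → u.1.val * p.elt = (κ : ℤ) • p.elt := by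
      intro p
      by_cases hp : p ∈ S
      · obtain ⟨-, κ, hκ⟩ := carries_act (hSu hp)
        have hp' : u.1.act p = p := hS1 hp
        rw [hp'] at hκ
        exact ⟨κ, fun _ => hκ⟩
      · exact ⟨1, fun h => absurd h hp⟩
    choose κ hκ using hκ
    have hB : ((WalksFrom.finite_basisOf hG hS).toFinset : Set (WalksFrom G R)) = basisOf S :=
      Set.Finite.coe_toFinset _
    generalize (WalksFrom.finite_basisOf hG hS).toFinset = B at hB
    have hBT := WalksFrom.isTreeBasis_of_coe_eq_basisOf hS hB
    refine ⟨B, κ, hBT, ?_⟩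
    obtain ⟨x, hx⟩ := exists_val_eq (G := G) (R := R)
      (a := ∑ b ∈ B, (κ b : ℤ) • (b.elt * star b.elt))
      (sum_mem fun b _ => Submodule.smul_mem _ _ (elt_mul_star_mem b b rfl))
    rw [← hx]
    refine congrArg val (ext_of_mul_elt hG hS fun q hq => ?_)
    obtain ⟨b, hb, hbq⟩ := exists_basisOf_le hq
    have hbB : b ∈ B := by rwa [← Finset.mem_coe, hB]
    rw [mul_elt_of_le (hκ b hb.1) hbq, mul_elt_of_val_eq_sum hBT hx hbB hbq]
  · rintro ⟨B, κ, hB, hx⟩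
    refine Subtype.ext (mk_toRep_eq_mk hG u AlmostAutRep.refl
      (WalksFrom.isCofiniteSubspace_upperClosure hB) (fun _ _ => trivial) ?_)
    rintro p ⟨b, hb, hbp⟩
    exact ⟨rfl, κ b, mul_elt_of_val_eq_sum hB hx hb hbp⟩

/-! ### Surjectivity -/

/-- A Higman-Thompson representative `φ` is induced by the unitary element `∑ φ(b) b*`, where `b`
runs through the basis of the domain of `φ`. -/
theorem toHT_surjective (hG : G.RowFinite) :
    Function.Surjective (toHT hG : unitary (RootedLPA G R) →* HT G R) := by
  rintro ⟨_, φ, hφ, rfl⟩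
  have hB : ((WalksFrom.finite_basisOf hG φ.source_cofinite).toFinset : Set (WalksFrom G R)) =
    basisOf φ.source := Set.Finite.coe_toFinset _
  generalize (WalksFrom.finite_basisOf hG φ.source_cofinite).toFinset = B at hB
  have hmem : ∀ {b}, b ∈ B ↔ b ∈ basisOf φ.source := by
    intro b
    rw [← Finset.mem_coe, hB]
  have hanti : ∀ b ∈ B, ∀ b' ∈ B, b ≤ b' → b = b' := fun b hb b' hb' h =>
    (hmem.1 hb').eq_of_le (hmem.1 hb).1 h
  have hanti' : ∀ b ∈ B, ∀ b' ∈ B, φ.toPartialEquiv b ≤ φ.toPartialEquiv b' → b = b' :=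
    fun b hb b' hb' h => hanti b hb b' hb'
      ((φ.map_le_map_iff b (hmem.1 hb).1 b' (hmem.1 hb').1).1 h)
  have hT : ∀ b ∈ B, (φ.toPartialEquiv b).T = b.T := fun b hb => (hφ b (hmem.1 hb)).1
  obtain ⟨x, hx⟩ := exists_val_eq (G := G) (R := R)
    (a := ∑ b ∈ B, (1 : ℤ) • ((φ.toPartialEquiv b).elt * star b.elt))
    (sum_mem fun b hb => Submodule.smul_mem _ _ (elt_mul_star_mem _ b (hT b hb)))
  have hx' : (star x).val = ∑ b ∈ B, (1 : ℤ) • (b.elt * star (φ.toPartialEquiv b).elt) := by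
    rw [val_star, hx, star_sum]
    refine Finset.sum_congr rfl fun b _ => ?_
    rw [star_zsmul, star_mul, star_star]
  -- `x p = φ(p)` and `x* φ(p) = p` hold on the basis, and pass to the walks above it.
  have hsource : ∀ p ∈ φ.source, x.Carries p (φ.toPartialEquiv p) ∧
      x.val * p.elt = (φ.toPartialEquiv p).elt ∧
      (star x).val * (φ.toPartialEquiv p).elt = p.elt := by
    intro p hp
    obtain ⟨b, hb, hbp⟩ := exists_basisOf_le hp
    obtain ⟨r, rfl⟩ := WalksFrom.le_iff_exists_append.1 hbp
    have hbB := hmem.2 hb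
    have h1 : x.val * b.elt = (1 : ℤ) • (φ.toPartialEquiv b).elt := by
      rw [hx]
      exact WalksFrom.sum_mul_elt B (fun _ => 1) φ.toPartialEquiv id hanti hT hbB
    have h2 : (star x).val * (φ.toPartialEquiv b).elt = (1 : ℤ) • b.elt := by
      rw [hx']
      exact WalksFrom.sum_mul_elt B (fun _ => 1) id φ.toPartialEquiv hanti'
        (fun b hb => (hT b hb).symm) hbB
    have hc : x.Carries b (φ.toPartialEquiv b) := ⟨hT b hbB, 1, h1⟩
    obtain ⟨q, hq, hcq, hval⟩ := hc.append r
    have hqφ : q = φ.toPartialEquiv (b.append r) := WalksFrom.ext (hq.trans ((hφ b hb).2 r).symm)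
    subst hqφ
    have h3 := hval 1 h1
    rw [one_smul] at h3 h2
    have hr : G.IsWalk (φ.toPartialEquiv b).T r.edges := by rw [hT b hbB]; exact r.isWalk
    have h4 : φ.toPartialEquiv (b.append r) = (φ.toPartialEquiv b).append ⟨r.edges, hr⟩ :=
      WalksFrom.ext hq
    refine ⟨hcq, h3, ?_⟩
    rw [h4, elt_append, elt_append, ← mul_assoc, h2]
    exact congrArg (fun v => b.elt * LPA.word G v r.edges) (hT b hbB)
  have hx1 : star x * x = 1 := by
    refine ext_of_mul_elt hG φ.source_cofinite fun p hp => ?_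
    obtain ⟨-, h1, h2⟩ := hsource p hp
    rw [val_mul, mul_assoc, h1, h2, val_one]
    exact (LPA.vert_mul_word p.isWalk).symm
  have hx2 : x * star x = 1 := by
    refine ext_of_mul_elt hG φ.target_cofinite fun p hp => ?_
    obtain ⟨-, h1, h2⟩ := hsource _ (φ.toPartialEquiv.map_target hp)
    rw [φ.toPartialEquiv.right_inv hp] at h1 h2
    rw [val_mul, mul_assoc, h2, h1, val_one]
    exact (LPA.vert_mul_word p.isWalk).symm
  exact ⟨⟨x, Unitary.mem_iff.2 ⟨hx1, hx2⟩⟩, Subtype.ext (mk_toRep_eq_mk hG _ φ φ.source_cofinite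
    subset_rfl fun p hp => (hsource p hp).1)⟩

end RootedLPA

end DirGraph

/-- For every rooted graph `(G, R)` in which every vertex emits finitely many edges, the diagonal
unitary elements form a normal subgroup of the unitary group of `L_ℤ(G, R)`, and the
quotient is isomorphic to the Higman-Thompson group of the unfolding tree. -/
theorem lemma9 {V E : Type*} (G : DirGraph V E) (R : V) (hR : G.IsRoot R) (hG : G.RowFinite) :
    ∃ (N : Subgroup (unitary (DirGraph.RootedLPA G R))) (_ : N.Normal),
      (Subtype.val '' (N : Set (unitary (DirGraph.RootedLPA G R))) = DirGraph.DU G R) ∧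
        Nonempty (DirGraph.HT G R ≃* unitary (DirGraph.RootedLPA G R) ⧸ N) := by
  refine ⟨(DirGraph.RootedLPA.toHT hG).ker, inferInstance, ?_,
    ⟨(QuotientGroup.quotientKerEquivOfSurjective _
      (DirGraph.RootedLPA.toHT_surjective hG)).symm⟩⟩
  ext x
  constructor
  · rintro ⟨u, hu, rfl⟩
    exact (DirGraph.RootedLPA.mem_ker_toHT_iff hG u).1 hu
  · intro hx
    exact ⟨⟨x, DirGraph.RootedLPA.mem_unitary_of_mem_DU hG hx⟩,
      (DirGraph.RootedLPA.mem_ker_toHT_iff hG _).2 hx, rfl⟩
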